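/- Let $G$ be a compact Hausdorff group with normalized (regular) Haar measure $m_G$, and let $\Phi:[0,\infty)\to[0,\infty)$ be a (finite-valued) Young function, i.e. $\Phi$ is convex, $\Phi(0)=0$ and $\Phi(x)\to\infty$ as $x\to\infty$. Assume that $\Phi$ satisfies the $\Delta_2$-condition: there are $K>0$, $x_0>0$ with $\Phi(2x)\le K\Phi(x)$ for all $x\ge x_0$. Let $L^\Phi(G)$ be the Orlicz space of (classes modulo $m_G$-null functions of) complex measurable functions $f$ on $G$ with $\|f\|_\Phi:=\inf\{k>0:\int_G\Phi(|f|/k)\,dm_G\le 1\}<\infty$, with the norm $\|\cdot\|_\Phi$. Let $\mu$ be a bounded complex Radon measure on $G$ with total variation norm $\|\mu\|=|\mu|(G)$ and with $\mu(G)\neq0$. Then convolution $T_{\Phi,\mu}f=\mu*f$, $(\mu*f)(t)=\int_G f(s^{-1}t)\,d\mu(s)$ (the integral converging absolutely for $m_G$-almost every $t$), is a bounded linear operator on $L^\Phi(G)$, and $\nu_{\Phi,\mu}(A)=T_{\Phi,\mu}(\chi_A)$, for Borel sets $A\subseteq G$, defines a $\sigma$-additive vector measure $\nu=\nu_{\Phi,\mu}$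 with values in $X=L^\Phi(G)$. For $x'$ in the dual $X'$ write $\langle\nu,x'\rangle$ for the complex measure $A\mapsto\langle\nu(A),x'\rangle$, and for measurable $f$ put $$\|f\|_{\nu}=\sup_{x'\in X',\ \|x'\|\le1}\int_G|f|\,d|\langle\nu,x'\rangle| .$$ Let $L^1(\nu)$ be the space, with the norm $\|\cdot\|_\nu$, of (classes modulo $\nu$-null functions of) measurable $f:G\to\mathbb{C}$ that are $\nu$-integrable: $f\in L^1(|\langle\nu,x'\rangle|)$ for all $x'\in X'$, and for every Borel set $A$ there is a (necessarily unique) $x_A\in X$ with $\int_A f\,d\langle\nu,x'\rangle=\langle x_A,x'\rangle$ for all $x'\in X'$. Then: (i) If $f\in L^\Phi(G)$, then $\|f\|_{\nu_{\Phi,\mu}}\le\|f\|_\Phi\,\|\mu\|$. (ii) Every $f\in L^\Phi(G)$ belongs to $L^1(\nu_{\Phi,\mu})$; the inclusion $\imath:L^\Phi(G)\to L^1(\nu_{\Phi,\mu})$ is well defined on classes, injective, linear and continuous, and its operator norm satisfies $|\mu(G)|\le\|\imath\|\le\|\mu\|$. -/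

import Mathlib

open MeasureTheory Filter Topology Set
open scoped ENNReal NNReal

namespace OrliczConv

/-! ### Young functions and Orlicz spaces -/

/-- A (finite-valued) Young function: a convex function `Φ : [0,∞) → [0,∞)` with `Φ 0 = 0` and
`Φ x → ∞` as `x → ∞`. -/
structure YoungFunction where
  toFun : ℝ≥0 → ℝ≥0
  convex' : ConvexOn ℝ≥0 univ toFun
  map_zero' : toFun 0 = 0
  tendsto' : Tendsto toFun atTop atTop

instance : CoeFun YoungFunction (fun _ => ℝ≥0 → ℝ≥0) := ⟨YoungFunction.toFun⟩

/-- The `Δ₂`-condition: `Φ (2x) ≤ K Φ x` for all `x ≥ x₀`. -/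
def YoungFunction.DeltaTwo (Φ : YoungFunction) : Prop :=
  ∃ K x₀ : ℝ≥0, 0 < K ∧ 0 < x₀ ∧ ∀ x, x₀ ≤ x → Φ (2 * x) ≤ K * Φ x

theorem YoungFunction.map_mul_le (Φ : YoungFunction) {a : ℝ≥0} (ha : a ≤ 1) (x : ℝ≥0) :
    Φ (a * x) ≤ a * Φ x := by
  have h := Φ.convex'.2 (mem_univ x) (mem_univ (0 : ℝ≥0)) (zero_le : 0 ≤ a)
    (zero_le : 0 ≤ 1 - a) (add_tsub_cancel_of_le ha)
  simpa [Φ.map_zero'] using h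

theorem YoungFunction.mono (Φ : YoungFunction) : Monotone Φ := by
  intro x y hxy
  rcases eq_or_ne y 0 with rfl | hy
  · rw [nonpos_iff_eq_zero.1 hxy]
  have h1 : x / y ≤ 1 := div_le_one_of_le₀ hxy zero_le
  have h := Φ.map_mul_le h1 y
  rw [div_mul_cancel₀ _ hy] at h
  exact h.trans (mul_le_of_le_one_left zero_le h1)

theorem YoungFunction.measurable (Φ : YoungFunction) : Measurable Φ := Φ.mono.measurable

section Orlicz

variable {α : Type*} [MeasurableSpace α]

/-- The modular `∫ Φ(|f| / k) dm`. -/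
noncomputable def modular (Φ : YoungFunction) (m : Measure α) (f : α → ℂ) (k : ℝ≥0) : ℝ≥0∞ :=
  ∫⁻ x, (Φ (‖f x‖₊ / k) : ℝ≥0∞) ∂m

/-- The Luxemburg norm `inf {k > 0 : ∫ Φ(|f| / k) dm ≤ 1}`, as an element of `[0,∞]`. -/
noncomputable def luxemburg (Φ : YoungFunction) (m : Measure α) (f : α → ℂ) : ℝ≥0∞ :=
  ⨅ (k : ℝ≥0) (_ : 0 < k ∧ modular Φ m f k ≤ 1), (k : ℝ≥0∞)

variable {Φ : YoungFunction} {m : Measure α}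

theorem luxemburg_congr {f g : α → ℂ} (h : f =ᵐ[m] g) : luxemburg Φ m f = luxemburg Φ m g := by
  have : ∀ k, modular Φ m f k = modular Φ m g k := fun k =>
    lintegral_congr_ae (h.mono fun x hx => by simp only [hx])
  simp only [luxemburg, this]

theorem luxemburg_le {f : α → ℂ} {k : ℝ≥0} (hk : 0 < k) (h : modular Φ m f k ≤ 1) :
    luxemburg Φ m f ≤ k := iInf₂_le k ⟨hk, h⟩

theorem exists_of_luxemburg_lt {f : α → ℂ} {a : ℝ≥0∞} (h : luxemburg Φ m f < a) :
    ∃ k : ℝ≥0, 0 < k ∧ modular Φ m f k ≤ 1 ∧ (k : ℝ≥0∞) < a := by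
  simp only [luxemburg, iInf_lt_iff] at h
  obtain ⟨k, ⟨h1, h2⟩, h3⟩ := h
  exact ⟨k, h1, h2, h3⟩

theorem luxemburg_zero : luxemburg Φ m (fun _ => 0) = 0 := by
  refine le_antisymm (ENNReal.le_of_forall_pos_le_add fun ε hε _ => ?_) zero_le
  simpa using luxemburg_le (Φ := Φ) (m := m) (f := fun _ => 0) hε
    (by simp [modular, Φ.map_zero'])

theorem luxemburg_const_mul_le (c : ℂ) (f : α → ℂ) :
    luxemburg Φ m (fun x => c * f x) ≤ ‖c‖₊ * luxemburg Φ m f := by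
  rcases eq_or_ne c 0 with rfl | hc
  · simp [luxemburg_zero]
  have hc' : (0 : ℝ≥0) < ‖c‖₊ := nnnorm_pos.2 hc
  simp only [luxemburg, ENNReal.mul_iInf_of_ne (ENNReal.coe_ne_zero.2 hc'.ne') ENNReal.coe_ne_top]
  refine le_iInf₂ fun k hk => ?_
  refine (luxemburg_le (Φ := Φ) (m := m) (mul_pos hc' hk.1) ?_).trans_eq (by simp)
  refine le_trans (le_of_eq ?_) hk.2
  refine lintegral_congr fun x => ?_
  simp only [nnnorm_mul]
  rw [mul_div_mul_left _ _ hc'.ne']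

theorem luxemburg_const_mul (c : ℂ) (f : α → ℂ) :
    luxemburg Φ m (fun x => c * f x) = ‖c‖₊ * luxemburg Φ m f := by
  refine le_antisymm (luxemburg_const_mul_le c f) ?_
  rcases eq_or_ne c 0 with rfl | hc
  · simp
  have h := luxemburg_const_mul_le (Φ := Φ) (m := m) c⁻¹ (fun x => c * f x)
  simp only [inv_mul_cancel_left₀ hc] at h
  calc (‖c‖₊ : ℝ≥0∞) * luxemburg Φ m f
      ≤ ‖c‖₊ * (‖c⁻¹‖₊ * luxemburg Φ m (fun x => c * f x)) := by gcongr
    _ = luxemburg Φ m (fun x => c * f x) := by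
      rw [← mul_assoc, ← ENNReal.coe_mul, ← nnnorm_mul, mul_inv_cancel₀ hc]; simp

theorem luxemburg_add_le {f g : α → ℂ} (hf : AEMeasurable f m) :
    luxemburg Φ m (fun x => f x + g x) ≤ luxemburg Φ m f + luxemburg Φ m g := by
  refine ENNReal.le_of_forall_pos_le_add fun ε hε hfin => ?_
  obtain ⟨hf1, hg1⟩ := ENNReal.add_lt_top.1 hfin
  have hε2 : ((ε / 2 : ℝ≥0) : ℝ≥0∞) ≠ 0 := by simpa using (half_pos hε).ne'
  obtain ⟨a, ha, ha1, ha2⟩ := exists_of_luxemburg_lt (ENNReal.lt_add_right hf1.ne hε2)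
  obtain ⟨b, hb, hb1, hb2⟩ := exists_of_luxemburg_lt (ENNReal.lt_add_right hg1.ne hε2)
  have hab : 0 < a + b := add_pos ha hb
  have key : modular Φ m (fun x => f x + g x) (a + b) ≤ 1 := by
    have h1 : ∀ x, (Φ (‖f x + g x‖₊ / (a + b)) : ℝ≥0∞) ≤
        ((a / (a + b) : ℝ≥0) : ℝ≥0∞) * (Φ (‖f x‖₊ / a) : ℝ≥0∞) +
          ((b / (a + b) : ℝ≥0) : ℝ≥0∞) * (Φ (‖g x‖₊ / b) : ℝ≥0∞) := by
      intro x
      norm_cast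
      have hc := Φ.convex'.2 (mem_univ (‖f x‖₊ / a)) (mem_univ (‖g x‖₊ / b))
        (zero_le : 0 ≤ a / (a + b)) (zero_le : 0 ≤ b / (a + b))
        (by rw [← add_div, div_self hab.ne'])
      refine le_trans (Φ.mono ?_) hc
      simp only [smul_eq_mul]
      rw [div_mul_div_comm, div_mul_div_comm, mul_comm a, mul_comm b, mul_div_mul_right _ _ ha.ne',
        mul_div_mul_right _ _ hb.ne', ← add_div]
      gcongr
      exact nnnorm_add_le _ _
    calc modular Φ m (fun x => f x + g x) (a + b)
        ≤ ∫⁻ x, (((a / (a + b) : ℝ≥0) : ℝ≥0∞) * (Φ (‖f x‖₊ / a) : ℝ≥0∞) +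
          ((b / (a + b) : ℝ≥0) : ℝ≥0∞) * (Φ (‖g x‖₊ / b) : ℝ≥0∞)) ∂m := lintegral_mono h1
      _ = ((a / (a + b) : ℝ≥0) : ℝ≥0∞) * modular Φ m f a +
          ((b / (a + b) : ℝ≥0) : ℝ≥0∞) * modular Φ m g b := by
        rw [lintegral_add_left', lintegral_const_mul' _ _ ENNReal.coe_ne_top,
          lintegral_const_mul' _ _ ENNReal.coe_ne_top]
        · rfl
        · exact ((Φ.measurable.comp_aemeasurable
            (hf.nnnorm.div_const a)).coe_nnreal_ennreal).const_mul _
      _ ≤ ((a / (a + b) : ℝ≥0) : ℝ≥0∞) * 1 + ((b / (a + b) : ℝ≥0) : ℝ≥0∞) * 1 := by gcongr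
      _ = 1 := by
        rw [mul_one, mul_one, ← ENNReal.coe_add, ← add_div, div_self hab.ne', ENNReal.coe_one]
  calc luxemburg Φ m (fun x => f x + g x) ≤ ((a + b : ℝ≥0) : ℝ≥0∞) := luxemburg_le hab key
    _ = a + b := by simp
    _ ≤ (luxemburg Φ m f + (ε / 2 : ℝ≥0)) + (luxemburg Φ m g + (ε / 2 : ℝ≥0)) := by gcongr
    _ = luxemburg Φ m f + luxemburg Φ m g + ε := by
      rw [add_add_add_comm, ← ENNReal.coe_add, add_halves]

theorem ae_eq_zero_of_luxemburg {f : α → ℂ} (hf : AEMeasurable f m) (h : luxemburg Φ m f = 0) :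
    f =ᵐ[m] 0 := by
  have hsmall : ∀ k : ℝ≥0, 0 < k → modular Φ m f k ≤ 1 := by
    intro k hk
    obtain ⟨j, hj, hj1, hj2⟩ := exists_of_luxemburg_lt (Φ := Φ) (m := m) (f := f)
      (a := (k : ℝ≥0∞)) (by rw [h]; exact_mod_cast hk)
    refine le_trans (lintegral_mono fun x => ?_) hj1
    have : j ≤ k := by exact_mod_cast hj2.le
    exact ENNReal.coe_le_coe.2 (Φ.mono (by gcongr))
  have hsets : ∀ n : ℕ, m {x | (1 / (n + 1 : ℝ≥0)) ≤ ‖f x‖₊} = 0 := by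
    intro n
    set ε : ℝ≥0 := 1 / (n + 1 : ℝ≥0) with hε
    have hεpos : 0 < ε := by positivity
    by_contra hne
    set A := {x | ε ≤ ‖f x‖₊}
    have hb : ∀ M : ℝ≥0, (M : ℝ≥0∞) * m A ≤ 1 := by
      intro M
      obtain ⟨y, hy, hy0⟩ := ((Φ.tendsto'.eventually_ge_atTop M).and
        (eventually_gt_atTop 0)).exists
      have hk : 0 < ε / y := div_pos hεpos hy0
      refine le_trans ?_ (hsmall _ hk)
      refine le_trans ?_ (mul_meas_ge_le_lintegral₀ (μ := m)
        (f := fun x => (Φ (‖f x‖₊ / (ε / y)) : ℝ≥0∞))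
        ((Φ.measurable.comp_aemeasurable (hf.nnnorm.div_const _)).coe_nnreal_ennreal) M)
      gcongr
      intro x hx
      change (M : ℝ≥0∞) ≤ _
      norm_cast
      refine hy.trans (Φ.mono ?_)
      rw [le_div_iff₀ hk, mul_div_cancel₀ _ hy0.ne']
      exact hx
    rcases eq_or_ne (m A) ∞ with htop | htop
    · have := hb 1
      simp [htop] at this
    · have h2 := hb (2 * (m A).toNNReal⁻¹)
      have h3 : (m A) = ((m A).toNNReal : ℝ≥0∞) := (ENNReal.coe_toNNReal htop).symm
      have h4 : (m A).toNNReal ≠ 0 := by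
        intro h0; rw [h0] at h3; exact hne (by simpa using h3)
      rw [h3, ← ENNReal.coe_mul] at h2
      simp only [ENNReal.toNNReal_coe] at h2
      rw [mul_assoc, inv_mul_cancel₀ h4] at h2
      norm_num at h2
  have hU : m (⋃ n : ℕ, {x | (1 / (n + 1 : ℝ≥0)) ≤ ‖f x‖₊}) = 0 := measure_iUnion_null hsets
  refine measure_mono_null (fun x hx => ?_) hU
  have hx' : f x ≠ 0 := hx
  obtain ⟨n, hn⟩ := exists_nat_one_div_lt (K := ℝ) (norm_pos_iff.2 hx')
  refine mem_iUnion.2 ⟨n, ?_⟩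
  change (1 / (n + 1 : ℝ≥0)) ≤ ‖f x‖₊
  rw [← NNReal.coe_le_coe]
  push_cast
  exact hn.le

/-- The Orlicz space `L^Φ(m)`, as a subspace of the space of classes of measurable functions
modulo equality almost everywhere. -/
def orliczSubmodule (Φ : YoungFunction) (m : Measure α) : Submodule ℂ (α →ₘ[m] ℂ) where
  carrier := {f | luxemburg Φ m f < ∞}
  zero_mem' := by
    have : luxemburg Φ m ((0 : α →ₘ[m] ℂ) : α → ℂ) = 0 :=
      (luxemburg_congr AEEqFun.coeFn_zero).trans luxemburg_zero
    simp [this]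
  add_mem' := by
    intro f g hf hg
    have h := (luxemburg_congr (Φ := Φ) (AEEqFun.coeFn_add f g)).trans_le
      (luxemburg_add_le f.aemeasurable)
    exact h.trans_lt (ENNReal.add_lt_top.2 ⟨hf, hg⟩)
  smul_mem' := by
    intro c f hf
    have h := (luxemburg_congr (Φ := Φ) (AEEqFun.coeFn_smul c f)).trans_le
      (luxemburg_const_mul_le c f)
    exact h.trans_lt (ENNReal.mul_lt_top ENNReal.coe_lt_top hf)

/-- The Orlicz space `L^Φ(m)` of classes of complex measurable functions. -/
def Orlicz (Φ : YoungFunction) (m : Measure α) : Type _ := ↥(orliczSubmodule Φ m)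

noncomputable instance : AddCommGroup (Orlicz Φ m) :=
  inferInstanceAs (AddCommGroup ↥(orliczSubmodule Φ m))

noncomputable instance : Module ℂ (Orlicz Φ m) :=
  inferInstanceAs (Module ℂ ↥(orliczSubmodule Φ m))

/-- A representative of an element of the Orlicz space. -/
noncomputable instance : CoeFun (Orlicz Φ m) (fun _ => α → ℂ) := ⟨fun f => (f.1 : α → ℂ)⟩

theorem Orlicz.coeFn_add (f g : Orlicz Φ m) : (f + g) =ᵐ[m] fun x => f x + g x :=
  AEEqFun.coeFn_add f.1 g.1

theorem Orlicz.coeFn_smul (c : ℂ) (f : Orlicz Φ m) : (c • f) =ᵐ[m] fun x => c * f x :=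
  AEEqFun.coeFn_smul c f.1

theorem Orlicz.aemeasurable (f : Orlicz Φ m) : AEMeasurable f m := f.1.aemeasurable

/-- `L^Φ(m)` with the Luxemburg norm. -/
noncomputable instance : NormedAddCommGroup (Orlicz Φ m) :=
  AddGroupNorm.toNormedAddCommGroup
    { toFun := fun f => (luxemburg Φ m f).toReal
      map_zero' := by
        have : luxemburg Φ m ((0 : Orlicz Φ m) : α → ℂ) = 0 :=
          (luxemburg_congr AEEqFun.coeFn_zero).trans luxemburg_zero
        simp [this]
      add_le' := fun f g => by
        have h := (luxemburg_congr (Φ := Φ) (Orlicz.coeFn_add f g)).trans_le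
          (luxemburg_add_le f.aemeasurable)
        have h1 : luxemburg Φ m f < ∞ := f.2
        have h2 : luxemburg Φ m g < ∞ := g.2
        exact ENNReal.toReal_le_add h h1.ne h2.ne
      neg' := fun f => by
        have h0 : (-f) = (-1 : ℂ) • f := by simp
        have h := (luxemburg_congr (Φ := Φ) (Orlicz.coeFn_smul (-1) f)).trans
          (luxemburg_const_mul (-1) f)
        rw [h0, h]; simp
      eq_zero_of_map_eq_zero' := fun f h => by
        have h1 : luxemburg Φ m f < ∞ := f.2
        have h2 : luxemburg Φ m f = 0 := ((ENNReal.toReal_eq_zero_iff _).1 h).resolve_right h1.ne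
        refine Subtype.ext (AEEqFun.ext ?_)
        exact (ae_eq_zero_of_luxemburg f.aemeasurable h2).trans AEEqFun.coeFn_zero.symm }

theorem Orlicz.norm_def (f : Orlicz Φ m) : ‖f‖ = (luxemburg Φ m f).toReal := rfl

noncomputable instance : NormedSpace ℂ (Orlicz Φ m) where
  norm_smul_le c f := by
    have h := (luxemburg_congr (Φ := Φ) (Orlicz.coeFn_smul c f)).trans (luxemburg_const_mul c f)
    rw [Orlicz.norm_def, Orlicz.norm_def, h]; simp

theorem luxemburg_indicator_lt_top [IsFiniteMeasure m] (A : Set α) :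
    luxemburg Φ m (A.indicator fun _ => 1) < ∞ := by
  set M : ℝ≥0 := Φ 1 * (m univ).toNNReal
  have hk : 0 < M + 1 := by positivity
  refine (luxemburg_le hk ?_).trans_lt ENNReal.coe_lt_top
  have h1 : ∀ x, (Φ (‖A.indicator (fun _ => (1 : ℂ)) x‖₊ / (M + 1)) : ℝ≥0∞) ≤
      (((M + 1)⁻¹ * Φ 1 : ℝ≥0) : ℝ≥0∞) := by
    intro x
    norm_cast
    refine le_trans (Φ.mono ?_) (Φ.map_mul_le (inv_le_one_of_one_le₀ (by simp)) 1)
    rw [div_eq_mul_inv, mul_comm]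
    gcongr
    by_cases hx : x ∈ A <;> simp [hx]
  refine (lintegral_mono h1).trans ?_
  rw [lintegral_const, ← ENNReal.coe_toNNReal (measure_ne_top m univ)]
  norm_cast
  rw [mul_assoc, inv_mul_eq_div]
  exact div_le_one_of_le₀ (by simp [M]) zero_le

/-- The class of the characteristic function `χ_A` in `L^Φ(m)`. -/
noncomputable def Orlicz.chi (Φ : YoungFunction) (m : Measure α) [IsFiniteMeasure m] (A : Set α)
    (hA : MeasurableSet A) : Orlicz Φ m :=
  ⟨AEEqFun.mk (A.indicator fun _ => 1)
      ((measurable_const.indicator hA).aestronglyMeasurable), by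
    change luxemburg Φ m _ < ∞
    rw [luxemburg_congr (AEEqFun.coeFn_mk _ _)]
    exact luxemburg_indicator_lt_top A⟩

end Orlicz

/-! ### Integration with respect to a vector measure -/

section VectorMeasure

variable {Ω : Type*} [MeasurableSpace Ω] {X : Type*} [NormedAddCommGroup X] [NormedSpace ℂ X]

/-- The scalar measure `⟨ν, x'⟩`. -/
noncomputable def scalarMeasure (ν : VectorMeasure Ω X) (ℓ : StrongDual ℂ X) : ComplexMeasure Ω :=
  ν.mapRange (ℓ : X →+ ℂ) ℓ.continuous

/-- `‖f‖_ν = sup_{‖x'‖ ≤ 1} ∫ |f| d|⟨ν, x'⟩|`, as an element of `[0,∞]`. -/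
noncomputable def vNorm (ν : VectorMeasure Ω X) (f : Ω → ℂ) : ℝ≥0∞ :=
  ⨆ (ℓ : StrongDual ℂ X) (_ : ‖ℓ‖ ≤ 1), ∫⁻ x, ‖f x‖ₑ ∂(scalarMeasure ν ℓ).variation

/-- `ν`-weak integrability of a measurable function. -/
def IsWeaklyIntegrable (ν : VectorMeasure Ω X) (f : Ω → ℂ) : Prop :=
  Measurable f ∧ ∀ ℓ : StrongDual ℂ X, (scalarMeasure ν ℓ).Integrable f

/-- `ν`-integrability: `f` is weakly integrable and each `A` measurable admits a vector
`x_A = ∫_A f dν` with `∫_A f d⟨ν, x'⟩ = ⟨x_A, x'⟩` for all `x'` (by Hahn--Banach, `x_A` is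
unique). -/
def IsVIntegrable (ν : VectorMeasure Ω X) (f : Ω → ℂ) : Prop :=
  IsWeaklyIntegrable ν f ∧ ∀ A, MeasurableSet A → ∃ xA : X, ∀ ℓ : StrongDual ℂ X,
    ((scalarMeasure ν ℓ).restrict A).integral f (ContinuousLinearMap.mul ℝ ℂ) = ℓ xA

variable {ν : VectorMeasure Ω X}

theorem scalarMeasure_apply (ℓ : StrongDual ℂ X) (A : Set Ω) : scalarMeasure ν ℓ A = ℓ (ν A) := rfl

theorem scalarMeasure_add (ℓ₁ ℓ₂ : StrongDual ℂ X) :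
    scalarMeasure ν (ℓ₁ + ℓ₂) = scalarMeasure ν ℓ₁ + scalarMeasure ν ℓ₂ := by
  ext A hA; simp [scalarMeasure_apply]

theorem scalarMeasure_smul (c : ℂ) (ℓ : StrongDual ℂ X) :
    scalarMeasure ν (c • ℓ) = c • scalarMeasure ν ℓ := by
  ext A hA; simp [scalarMeasure_apply]

theorem lowerSemicontinuous_variation {A : Set Ω} (hA : MeasurableSet A) :
    LowerSemicontinuous fun ℓ : StrongDual ℂ X => (scalarMeasure ν ℓ).variation A := by
  intro ℓ a ha
  obtain ⟨P, h1, h2, -, h4⟩ := VectorMeasure.exists_lt_sum_of_lt_variation _ hA ha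
  have hc : Continuous fun ℓ' : StrongDual ℂ X => ∑ p ∈ P, ‖scalarMeasure ν ℓ' p‖ₑ := by
    refine continuous_finsetSum _ fun p _ => Continuous.enorm ?_
    simp only [scalarMeasure_apply]
    exact (ContinuousLinearMap.apply ℂ ℂ (ν p)).continuous
  filter_upwards [hc.continuousAt.eventually_const_lt h4] with ℓ' h
  exact h.trans_le (VectorMeasure.le_variation _ hA h1 h2)

theorem lowerSemicontinuous_lintegral (g : Ω → ℝ≥0∞) :
    LowerSemicontinuous fun ℓ : StrongDual ℂ X => ∫⁻ x, g x ∂(scalarMeasure ν ℓ).variation := by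
  simp only [lintegral_eq_nnreal]
  refine lowerSemicontinuous_iSup fun φ => lowerSemicontinuous_iSup fun _ => ?_
  simp only [SimpleFunc.lintegral]
  refine lowerSemicontinuous_sum fun c hc => ?_
  have hct : c ≠ ∞ := by
    obtain ⟨x, rfl⟩ := SimpleFunc.mem_range.1 hc
    simp
  exact (ENNReal.continuous_const_mul hct).comp_lowerSemicontinuous
    (lowerSemicontinuous_variation (SimpleFunc.measurableSet_fiber _ _))
    fun _ _ h => mul_le_mul_right h c

/-- The norm `‖f‖_ν` is finite for weakly integrable `f`, by the uniform boundedness principle. -/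
theorem vNorm_lt_top {f : Ω → ℂ} (hf : IsWeaklyIntegrable ν f) : vNorm ν f < ∞ := by
  set p : StrongDual ℂ X → ℝ≥0∞ := fun ℓ => ∫⁻ x, ‖f x‖ₑ ∂(scalarMeasure ν ℓ).variation with hp
  have hfin : ∀ ℓ, p ℓ ≠ ∞ := fun ℓ => (hf.2 ℓ).2.ne
  let q : Seminorm ℂ (StrongDual ℂ X) := Seminorm.of (fun ℓ => (p ℓ).toReal)
    (fun ℓ₁ ℓ₂ => by
      refine ENNReal.toReal_le_add ?_ (hfin _) (hfin _)
      simp only [hp, scalarMeasure_add]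
      rw [← lintegral_add_measure]
      exact lintegral_mono' VectorMeasure.variation_add_le le_rfl)
    (fun c ℓ => by
      simp only [hp, scalarMeasure_smul, VectorMeasure.variation_smul, lintegral_smul_measure]
      simp [ENNReal.smul_def])
  have hq : LowerSemicontinuous q := by
    intro ℓ y hy
    change y < (p ℓ).toReal at hy
    rcases lt_or_ge y 0 with hy0 | hy0
    · exact Eventually.of_forall fun ℓ' => hy0.trans_le ENNReal.toReal_nonneg
    · have h := lowerSemicontinuous_lintegral (ν := ν) (fun x => ‖f x‖ₑ) ℓ (ENNReal.ofReal y)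
        ((ENNReal.ofReal_lt_iff_lt_toReal hy0 (hfin ℓ)).2 hy)
      filter_upwards [h] with ℓ' h'
      exact (ENNReal.ofReal_lt_iff_lt_toReal hy0 (hfin ℓ')).1 h'
  obtain ⟨C, hC, hb⟩ := Seminorm.bound_of_continuous_normedSpace q
    (q.continuous_of_lowerSemicontinuous hq)
  refine lt_of_le_of_lt (iSup₂_le fun ℓ hℓ => ?_) (ENNReal.ofReal_lt_top (r := C))
  change p ℓ ≤ _
  rw [← ENNReal.ofReal_toReal (hfin ℓ)]
  refine ENNReal.ofReal_le_ofReal ((hb ℓ).trans ?_)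
  exact mul_le_of_le_one_right hC.le hℓ

theorem integral_const_mul (lam : ComplexMeasure Ω) (c : ℂ) (f : Ω → ℂ) :
    lam.integral (c • f) (ContinuousLinearMap.mul ℝ ℂ) =
      c * lam.integral f (ContinuousLinearMap.mul ℝ ℂ) := by
  rw [VectorMeasure.integral_eq_setToFun, VectorMeasure.integral_eq_setToFun, ← smul_eq_mul]
  refine setToFun_smul _ (fun c s x => ?_) c f
  simp [VectorMeasure.transpose]
  ring

theorem vNorm_zero : vNorm ν (fun _ => 0) = 0 := by simp [vNorm]

theorem vNorm_const_mul (c : ℂ) (f : Ω → ℂ) :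
    vNorm ν (fun x => c * f x) = ‖c‖ₑ * vNorm ν f := by
  simp only [vNorm, enorm_mul, lintegral_const_mul' _ _ enorm_ne_top, ENNReal.mul_iSup]

theorem vNorm_add_le {f g : Ω → ℂ} (hf : Measurable f) :
    vNorm ν (fun x => f x + g x) ≤ vNorm ν f + vNorm ν g := by
  refine iSup₂_le fun ℓ hℓ => ?_
  calc ∫⁻ x, ‖f x + g x‖ₑ ∂(scalarMeasure ν ℓ).variation
      ≤ ∫⁻ x, (‖f x‖ₑ + ‖g x‖ₑ) ∂(scalarMeasure ν ℓ).variation :=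
        lintegral_mono fun x => enorm_add_le _ _
    _ = _ := lintegral_add_left hf.enorm _
    _ ≤ _ := by
      refine add_le_add ?_ ?_
      · exact le_iSup₂_of_le (f := fun (ℓ : StrongDual ℂ X) (_ : ‖ℓ‖ ≤ 1) =>
          ∫⁻ x, ‖f x‖ₑ ∂(scalarMeasure ν ℓ).variation) ℓ hℓ le_rfl
      · exact le_iSup₂_of_le (f := fun (ℓ : StrongDual ℂ X) (_ : ‖ℓ‖ ≤ 1) =>
          ∫⁻ x, ‖g x‖ₑ ∂(scalarMeasure ν ℓ).variation) ℓ hℓ le_rfl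

/-- The vector space of `ν`-integrable functions. -/
def integrableSubmodule (ν : VectorMeasure Ω X) : Submodule ℂ (Ω → ℂ) where
  carrier := {f | IsVIntegrable ν f}
  zero_mem' := by
    refine ⟨⟨measurable_const, fun ℓ => integrable_zero _ _ _⟩, fun A hA => ⟨0, fun ℓ => ?_⟩⟩
    rw [map_zero]
    exact VectorMeasure.integral_zero
  add_mem' := by
    rintro f g ⟨⟨hf1, hf2⟩, hf3⟩ ⟨⟨hg1, hg2⟩, hg3⟩
    refine ⟨⟨hf1.add hg1, fun ℓ => (hf2 ℓ).add (hg2 ℓ)⟩, fun A hA => ?_⟩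
    obtain ⟨x, hx⟩ := hf3 A hA
    obtain ⟨y, hy⟩ := hg3 A hA
    refine ⟨x + y, fun ℓ => ?_⟩
    rw [map_add, ← hx, ← hy]
    exact VectorMeasure.integral_add (hf2 ℓ).restrict (hg2 ℓ).restrict
  smul_mem' := by
    rintro c f ⟨⟨hf1, hf2⟩, hf3⟩
    refine ⟨⟨hf1.const_smul c, fun ℓ => MeasureTheory.Integrable.smul c (hf2 ℓ)⟩,
      fun A hA => ?_⟩
    obtain ⟨x, hx⟩ := hf3 A hA
    refine ⟨c • x, fun ℓ => ?_⟩
    rw [map_smul, ← hx, smul_eq_mul]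
    exact integral_const_mul _ _ _

/-- The space of `ν`-integrable functions, before identifying functions that are equal
`ν`-almost everywhere. -/
def PreL1 (ν : VectorMeasure Ω X) : Type _ := ↥(integrableSubmodule ν)

noncomputable instance : AddCommGroup (PreL1 ν) :=
  inferInstanceAs (AddCommGroup ↥(integrableSubmodule ν))

noncomputable instance : Module ℂ (PreL1 ν) :=
  inferInstanceAs (Module ℂ ↥(integrableSubmodule ν))

noncomputable instance : SeminormedAddCommGroup (PreL1 ν) :=
  AddGroupSeminorm.toSeminormedAddCommGroup
    { toFun := fun f => (vNorm ν f.1).toReal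
      map_zero' := by
        have : vNorm ν (0 : PreL1 ν).1 = 0 := vNorm_zero
        simp [this]
      add_le' := fun f g =>
        ENNReal.toReal_le_add (vNorm_add_le f.2.1.1) (vNorm_lt_top f.2.1).ne (vNorm_lt_top g.2.1).ne
      neg' := fun f => by
        have h0 : (-f) = (-1 : ℂ) • f := by simp
        have h : vNorm ν ((-1 : ℂ) • f).1 = _ := vNorm_const_mul (-1) f.1
        rw [h0, h]; simp }

theorem PreL1.norm_def (f : PreL1 ν) : ‖f‖ = (vNorm ν f.1).toReal := rfl

noncomputable instance : NormedSpace ℂ (PreL1 ν) where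
  norm_smul_le c f := by
    have h : vNorm ν (c • f).1 = _ := vNorm_const_mul c f.1
    rw [PreL1.norm_def, PreL1.norm_def, h]; simp

/-- The normed space `L¹(ν)`: the `ν`-integrable functions with the norm `‖·‖_ν`, where `f` and
`g` are identified if `‖f - g‖_ν = 0`, that is, if they differ on a `ν`-null set only. -/
abbrev VL1 (ν : VectorMeasure Ω X) : Type _ := SeparationQuotient (PreL1 ν)

/-- The class in `L¹(ν)` of a `ν`-integrable function. -/
noncomputable def VL1.mk (f : Ω → ℂ) (hf : IsVIntegrable ν f) : VL1 ν :=
  SeparationQuotient.mk (⟨f, hf⟩ : PreL1 ν)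

end VectorMeasure

/-! ### The convolution operator and its vector measure -/

section Convolution

variable {G : Type*} [Group G] [MeasurableSpace G]

/-- `(μ * f)(t) = ∫ f(s⁻¹ t) dμ(s)`. -/
noncomputable def conv (μ : ComplexMeasure G) (f : G → ℂ) (t : G) : ℂ :=
  μ.integral (fun s => f (s⁻¹ * t)) (ContinuousLinearMap.mul ℝ ℂ)

variable {Φ : YoungFunction} {m : Measure G}

/-- `T` is the convolution operator `f ↦ μ * f` on `L^Φ(G)`: for every `f`, the integral that
defines `μ * f` converges absolutely almost everywhere, and `T f = μ * f` almost everywhere. These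
properties determine `T`. -/
def IsConvolutionOperator (μ : ComplexMeasure G) (T : Orlicz Φ m →L[ℂ] Orlicz Φ m) : Prop :=
  ∀ f : Orlicz Φ m, (∀ᵐ t ∂m, μ.Integrable fun s => f (s⁻¹ * t)) ∧ T f =ᵐ[m] conv μ f

/-- `ν` is the vector measure `A ↦ T χ_A` associated with `T`. -/
def IsAssociatedMeasure [IsFiniteMeasure m] (T : Orlicz Φ m →L[ℂ] Orlicz Φ m)
    (ν : VectorMeasure G (Orlicz Φ m)) : Prop :=
  ∀ A (hA : MeasurableSet A), ν A = T (Orlicz.chi Φ m A hA)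

/-- `ι` is the inclusion of `L^Φ(G)` into `L¹(ν)`: the class of `f` modulo `m`-null functions is
sent to the class of `f` modulo `ν`-null functions, for each measurable representative, and no two
classes are identified. -/
def IsInclusion (ν : VectorMeasure G (Orlicz Φ m)) (ι : Orlicz Φ m →L[ℂ] VL1 ν) : Prop :=
  (∀ (f : Orlicz Φ m) (g : G → ℂ), Measurable g → g =ᵐ[m] f →
    ∃ hg : IsVIntegrable ν g, ι f = VL1.mk g hg) ∧ Function.Injective ι

end Convolution

end OrliczConv

/-!
Jensen's inequality for the normalised variation of `μ`, integrated over `G` by left invariance,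
bounds the modular of `μ * f` by that of `f`, whence `‖T‖ ≤ ‖μ‖` for the convolution operator `T`.

For any bounded operator `T` on `L^Φ`, the `Δ₂`-condition gives dominated convergence in the
Luxemburg norm. It makes `ν : A ↦ T χ_A` countably additive and extends
`∫ f d⟨ν, x'⟩ = ⟨T f, x'⟩` from simple functions to all of `L^Φ`, so that `L^Φ ⊆ L¹(ν)`. If `h` is
the phase of `⟨ν, x'⟩`, then `∫ |f| d|⟨ν, x'⟩| = ⟨T (|f| h̄), x'⟩ ≤ ‖T‖ ‖f‖_Φ ‖x'‖`, which bounds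
`‖f‖_ν`.

Integrating `μ * χ_A` over `G` gives `μ(G) m(A)`; hence `ν` and `m` have the same null sets when
`μ(G) ≠ 0`, and the inclusion is injective. The lower bound for its norm comes from `μ * 1 = μ(G)`.
-/

namespace OrliczConv

section ComplexMeasure

variable {Ω : Type*} [MeasurableSpace Ω]

theorem variation_le_totalVariation_re_add_im (μ : ComplexMeasure Ω) :
    μ.variation ≤
      (ComplexMeasure.re μ).totalVariation + (ComplexMeasure.im μ).totalVariation := by
  refine VectorMeasure.variation_le_of_forall_enorm_le fun s _ => ?_
  calc ‖μ s‖ₑ = ‖((μ s).re : ℂ) + (μ s).im * Complex.I‖ₑ := by rw [Complex.re_add_im]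
    _ ≤ ‖(μ s).re‖ₑ + ‖(μ s).im‖ₑ := (enorm_add_le _ _).trans_eq (by simp [← ofReal_norm])
    _ ≤ _ := add_le_add (SignedMeasure.enorm_le_totalVariation (ComplexMeasure.re μ) s)
      (SignedMeasure.enorm_le_totalVariation (ComplexMeasure.im μ) s)

instance isFiniteMeasure_variation (μ : ComplexMeasure Ω) : IsFiniteMeasure μ.variation :=
  isFiniteMeasure_of_le _ (variation_le_totalVariation_re_add_im μ)

theorem absolutelyContinuous_variation (μ : ComplexMeasure Ω) :
    μ ≪ᵥ μ.variation.toENNRealVectorMeasure := by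
  refine VectorMeasure.AbsolutelyContinuous.mk fun s hs h => ?_
  rw [Measure.toENNRealVectorMeasure_apply_measurable hs] at h
  simpa [h] using VectorMeasure.enorm_measure_le_variation μ s

theorem measurable_rnDeriv (μ : ComplexMeasure Ω) (ρ : Measure Ω) : Measurable (μ.rnDeriv ρ) :=
  Complex.measurableEquivRealProd.symm.measurable.comp
    ((SignedMeasure.measurable_rnDeriv _ _).prodMk (SignedMeasure.measurable_rnDeriv _ _))

theorem withDensityᵥ_rnDeriv {μ : ComplexMeasure Ω} {ρ : Measure Ω} [SigmaFinite ρ]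
    (h : μ ≪ᵥ ρ.toENNRealVectorMeasure) : ρ.withDensityᵥ (μ.rnDeriv ρ) = μ := by
  have singularPart_eq_zero : ∀ s : SignedMeasure Ω, s ≪ᵥ ρ.toENNRealVectorMeasure →
      s.singularPart ρ = 0 := fun s hs => by
    simpa [(SignedMeasure.absolutelyContinuous_iff_withDensityᵥ_rnDeriv_eq s ρ).1 hs]
      using s.singularPart_add_withDensity_rnDeriv_eq ρ
  obtain ⟨hre, him⟩ := (ComplexMeasure.absolutelyContinuous_ennreal_iff _ _).1 h
  have : μ.HaveLebesgueDecomposition ρ := ⟨inferInstance, inferInstance⟩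
  have hsing : μ.singularPart ρ = 0 := by
    rw [ComplexMeasure.singularPart, singularPart_eq_zero _ hre, singularPart_eq_zero _ him]
    rfl
  simpa [hsing] using ComplexMeasure.singularPart_add_withDensity_rnDeriv_eq (c := μ) (μ := ρ)

theorem ae_norm_rnDeriv_variation (μ : ComplexMeasure Ω) :
    ∀ᵐ x ∂μ.variation, ‖μ.rnDeriv μ.variation x‖ = 1 := by
  have hint := ComplexMeasure.integrable_rnDeriv μ μ.variation
  have h : μ.variation.withDensity (fun x => ‖μ.rnDeriv μ.variation x‖ₑ) =
      μ.variation.withDensity 1 := by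
    rw [withDensity_one, ← Measure.variation_withDensityᵥ hint,
      withDensityᵥ_rnDeriv (absolutelyContinuous_variation μ)]
  have h1 := (withDensity_eq_iff (measurable_rnDeriv _ _).enorm.aemeasurable
    measurable_one.aemeasurable hint.2.ne).1 h
  filter_upwards [h1] with x hx
  simpa [← ofReal_norm] using hx

open scoped Classical in
/-- The phase of a complex measure `μ`: the density of `μ` with respect to its variation, modified
on a null set so that it has modulus one everywhere. -/
noncomputable def phase (μ : ComplexMeasure Ω) : Ω → ℂ :=
  {x | ‖μ.rnDeriv μ.variation x‖ = 1}.piecewise (μ.rnDeriv μ.variation) 1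

variable (μ : ComplexMeasure Ω)

theorem measurable_phase : Measurable (phase μ) :=
  (measurable_rnDeriv μ _).piecewise
    ((measurable_rnDeriv μ _).norm (measurableSet_singleton 1)) measurable_const

@[simp] theorem norm_phase (x : Ω) : ‖phase μ x‖ = 1 := by
  by_cases hx : ‖μ.rnDeriv μ.variation x‖ = 1 <;> simp [phase, hx]

theorem enorm_phase (x : Ω) : ‖phase μ x‖ₑ = 1 := by simp [← ofReal_norm]

theorem integrable_phase : Integrable (phase μ) μ.variation :=
  .of_bound (measurable_phase μ).aestronglyMeasurable 1 (.of_forall fun x => (norm_phase μ x).le)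

theorem phase_ae_eq_rnDeriv : phase μ =ᵐ[μ.variation] μ.rnDeriv μ.variation := by
  filter_upwards [ae_norm_rnDeriv_variation μ] with x hx
  exact piecewise_eq_of_mem _ _ _ hx

theorem withDensityᵥ_phase : μ.variation.withDensityᵥ (phase μ) = μ :=
  (WithDensityᵥEq.congr_ae (phase_ae_eq_rnDeriv μ)).trans
    (withDensityᵥ_rnDeriv (absolutelyContinuous_variation μ))

variable {μ}

theorem integrable_mul_phase {f : Ω → ℂ} (hf : Integrable f μ.variation) :
    Integrable (fun x => f x * phase μ x) μ.variation :=
  hf.mul_bdd (c := 1) (integrable_phase μ).1 (.of_forall fun x => (norm_phase μ x).le)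

theorem continuous_integral_mul_phase :
    Continuous fun f : Ω →₁[μ.variation] ℂ => ∫ x, f x * phase μ x ∂μ.variation := by
  refine continuous_iff_continuousAt.2 fun f => ?_
  refine tendsto_integral_of_L1 _ (integrable_mul_phase (L1.integrable_coeFn f)).1
    (.of_forall fun g => integrable_mul_phase (L1.integrable_coeFn g)) ?_
  have h : Continuous fun g : Ω →₁[μ.variation] ℂ => edist g f := by fun_prop
  have hdist : ∀ g : Ω →₁[μ.variation] ℂ,
      ∫⁻ x, ‖g x * phase μ x - f x * phase μ x‖ₑ ∂μ.variation = edist g f := fun g => by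
    rw [L1.edist_def]
    simp only [← sub_mul, enorm_mul, enorm_phase, mul_one, edist_eq_enorm_sub]
  simpa [hdist] using h.tendsto f

theorem integral_eq_integral_mul_phase {f : Ω → ℂ} (hf : μ.Integrable f) :
    μ.integral f (ContinuousLinearMap.mul ℝ ℂ) = ∫ x, f x * phase μ x ∂μ.variation := by
  refine Integrable.induction (μ := μ.variation)
    (fun f => μ.integral f (ContinuousLinearMap.mul ℝ ℂ) = ∫ x, f x * phase μ x ∂μ.variation)
    ?indicator ?add (isClosed_eq VectorMeasure.continuous_integral continuous_integral_mul_phase)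
    ?congr hf
  case indicator =>
    intro c s hs _
    have hμs : μ s = ∫ x in s, phase μ x ∂μ.variation := by
      rw [← withDensityᵥ_apply (integrable_phase μ) hs, withDensityᵥ_phase]
    simp only [← indicator_mul_left]
    rw [VectorMeasure.integral_indicator_const c hs, MeasureTheory.integral_indicator hs,
      MeasureTheory.integral_const_mul, ← hμs, ContinuousLinearMap.mul_apply']
  case add =>
    intro f g _ hf hg hf' hg'
    rw [VectorMeasure.integral_add hf hg, hf', hg',
      ← MeasureTheory.integral_add (integrable_mul_phase hf) (integrable_mul_phase hg)]
    simp only [Pi.add_apply, add_mul]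
  case congr =>
    intro f g hfg _ hf'
    rw [← VectorMeasure.integral_congr_ae hfg, hf']
    exact integral_congr_ae (hfg.mono fun x hx => by simp only [hx])

end ComplexMeasure

namespace YoungFunction

variable (Φ : YoungFunction)

/-- The extension of a Young function to the real line by `0` on the negative half-line, for use
with the results on convex functions on real vector spaces. -/
noncomputable def realExt (x : ℝ) : ℝ := Φ x.toNNReal

theorem realExt_coe (x : ℝ≥0) : Φ.realExt x = Φ x := by rw [realExt, Real.toNNReal_coe]

theorem convexOn_realExt : ConvexOn ℝ univ Φ.realExt := by
  refine ⟨convex_univ, fun x _ y _ a b ha hb hab => ?_⟩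
  have hconvex := Φ.convex'.2 (mem_univ x.toNNReal) (mem_univ y.toNNReal)
    (zero_le : 0 ≤ a.toNNReal) (zero_le : 0 ≤ b.toNNReal)
    (by rw [← Real.toNNReal_add ha hb, hab, Real.toNNReal_one])
  have hle : (a • x + b • y).toNNReal ≤ a.toNNReal • x.toNNReal + b.toNNReal • y.toNNReal := by
    refine Real.toNNReal_add_le.trans_eq ?_
    simp only [smul_eq_mul, Real.toNNReal_mul ha, Real.toNNReal_mul hb]
  simpa [realExt, ha, hb] using NNReal.coe_le_coe.2 ((Φ.mono hle).trans hconvex)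

theorem continuous_realExt : Continuous Φ.realExt :=
  continuousOn_univ.1 (Φ.convexOn_realExt.continuousOn isOpen_univ)

theorem continuous : Continuous Φ :=
  NNReal.isEmbedding_coe.continuous_iff.2 <|
    (Φ.continuous_realExt.comp NNReal.continuous_coe).congr Φ.realExt_coe

theorem exists_le_add_mul : ∃ y : ℝ≥0, ∀ x, x ≤ y + y * Φ x := by
  obtain ⟨y, hΦy, hy⟩ := ((Φ.tendsto'.eventually_ge_atTop 1).and (eventually_gt_atTop 0)).exists
  refine ⟨y, fun x => ?_⟩
  rcases le_total x y with hxy | hyx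
  · exact hxy.trans (by simp)
  have hx : 0 < x := hy.trans_le hyx
  have hconvex : Φ y ≤ y / x * Φ x := by
    simpa [div_mul_cancel₀ _ hx.ne'] using Φ.map_mul_le (div_le_one_of_le₀ hyx zero_le) x
  have hle : 1 ≤ y * Φ x / x := (hΦy.trans hconvex).trans_eq (div_mul_eq_mul_div _ _ _)
  rw [le_div_iff₀ hx, one_mul] at hle
  exact hle.trans (by simp)

theorem DeltaTwo.exists_le_mul_add {Φ : YoungFunction} (hΦ : Φ.DeltaTwo) :
    ∃ K C : ℝ≥0, ∀ x, Φ (2 * x) ≤ K * Φ x + C := by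
  obtain ⟨K, x₀, -, -, h⟩ := hΦ
  refine ⟨K, Φ (2 * x₀), fun x => ?_⟩
  rcases le_total x₀ x with hx | hx
  · exact (h x hx).trans (le_add_of_nonneg_right zero_le)
  · exact (Φ.mono (by gcongr)).trans (le_add_of_nonneg_left zero_le)

theorem map_laverage_le {Ω : Type*} [MeasurableSpace Ω] {ρ : Measure Ω} [IsFiniteMeasure ρ]
    [NeZero ρ] {f : Ω → ℝ≥0} (hf : AEMeasurable f ρ) (hfi : ∫⁻ x, f x ∂ρ ≠ ∞) :
    (Φ (⨍⁻ x, f x ∂ρ).toNNReal : ℝ≥0∞) ≤ ⨍⁻ x, Φ (f x) ∂ρ := by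
  have hΦf : AEMeasurable (fun x => (Φ (f x) : ℝ≥0∞)) ρ :=
    (Φ.measurable.comp_aemeasurable hf).coe_nnreal_ennreal
  rcases eq_or_ne (∫⁻ x, Φ (f x) ∂ρ) ∞ with htop | htop
  · simp [laverage_eq, htop, ENNReal.top_div, measure_ne_top]
  have hint : Integrable (fun x => (f x : ℝ)) ρ :=
    integrable_toReal_of_lintegral_ne_top hf.coe_nnreal_ennreal hfi
  have hΦint : Integrable (Φ.realExt ∘ fun x => (f x : ℝ)) ρ :=
    (integrable_toReal_of_lintegral_ne_top hΦf htop).congr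
      (.of_forall fun x => (Φ.realExt_coe (f x)).symm)
  have hjensen := Φ.convexOn_realExt.map_average_le Φ.continuous_realExt.continuousOn isClosed_univ
    (.of_forall fun _ => mem_univ _) hint hΦint
  have hleft : ⨍ x, (f x : ℝ) ∂ρ = (⨍⁻ x, f x ∂ρ).toNNReal :=
    (toReal_laverage hf.coe_nnreal_ennreal (by simp)).symm
  have hright : ⨍ x, Φ.realExt (f x) ∂ρ = (⨍⁻ x, Φ (f x) ∂ρ).toReal := by
    simp only [realExt_coe]
    exact (toReal_laverage hΦf (by simp)).symm
  rw [hleft, hright, realExt_coe] at hjensen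
  exact (ENNReal.ofReal_coe_nnreal.symm.trans_le
    (ENNReal.ofReal_le_ofReal hjensen)).trans ENNReal.ofReal_toReal_le

end YoungFunction

section Orlicz

variable {α : Type*} [MeasurableSpace α] {m : Measure α} {Φ : YoungFunction}

theorem YoungFunction.aemeasurable_nnnorm_div (Φ : YoungFunction) {f : α → ℂ}
    (hf : AEMeasurable f m) (k : ℝ≥0) : AEMeasurable (fun x => (Φ (‖f x‖₊ / k) : ℝ≥0∞)) m :=
  (Φ.measurable.comp_aemeasurable (hf.nnnorm.div_const k)).coe_nnreal_ennreal

theorem modular_antitone (f : α → ℂ) {j k : ℝ≥0} (hj : 0 < j) (hjk : j ≤ k) :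
    modular Φ m f k ≤ modular Φ m f j :=
  lintegral_mono fun _ => ENNReal.coe_le_coe.2 (Φ.mono (by gcongr))

theorem luxemburg_mono {f g : α → ℂ} (h : ∀ᵐ x ∂m, ‖f x‖ ≤ ‖g x‖) :
    luxemburg Φ m f ≤ luxemburg Φ m g := by
  refine le_iInf₂ fun k hk => luxemburg_le hk.1 (le_trans (lintegral_mono_ae ?_) hk.2)
  filter_upwards [h] with x hx
  have hx' : ‖f x‖₊ ≤ ‖g x‖₊ := hx
  exact ENNReal.coe_le_coe.2 (Φ.mono (by gcongr))

theorem luxemburg_const_lt_top [IsFiniteMeasure m] (c : ℂ) : luxemburg Φ m (fun _ => c) < ∞ := by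
  have h := luxemburg_const_mul_le (Φ := Φ) (m := m) c (univ.indicator fun _ => 1)
  simp only [indicator_univ, mul_one] at h
  refine h.trans_lt (ENNReal.mul_lt_top ENNReal.coe_lt_top ?_)
  simpa only [indicator_univ] using luxemburg_indicator_lt_top (Φ := Φ) (m := m) univ

theorem luxemburg_lt_top_of_bound [IsFiniteMeasure m] {f : α → ℂ} {C : ℝ} (h : ∀ x, ‖f x‖ ≤ C) :
    luxemburg Φ m f < ∞ :=
  (luxemburg_mono (g := fun _ => (C : ℂ)) (.of_forall fun x =>
    (h x).trans ((le_abs_self C).trans_eq (Complex.norm_real C).symm))).trans_lt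
      (luxemburg_const_lt_top _)

theorem luxemburg_simpleFunc_lt_top [IsFiniteMeasure m] (s : SimpleFunc α ℂ) :
    luxemburg Φ m s < ∞ :=
  luxemburg_lt_top_of_bound s.exists_forall_norm_le.choose_spec

theorem lintegral_enorm_le_modular {y : ℝ≥0} (hy : ∀ x, x ≤ y + y * Φ x) (f : α → ℂ) {k : ℝ≥0}
    (hk : 0 < k) : ∫⁻ x, ‖f x‖ₑ ∂m ≤ k * y * (m univ + modular Φ m f k) := by
  calc ∫⁻ x, ‖f x‖ₑ ∂m ≤ ∫⁻ x, ((k * y : ℝ≥0) : ℝ≥0∞) * (1 + Φ (‖f x‖₊ / k)) ∂m := by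
        refine lintegral_mono fun x => ?_
        have hle := hy (‖f x‖₊ / k)
        rw [div_le_iff₀ hk] at hle
        simp only [enorm_eq_nnnorm]
        norm_cast
        exact hle.trans_eq (by ring)
    _ = k * y * (m univ + modular Φ m f k) := by
        rw [lintegral_const_mul' _ _ ENNReal.coe_ne_top, lintegral_add_left measurable_const,
          lintegral_one, ENNReal.coe_mul, modular]

theorem integrable_of_luxemburg_lt_top [IsFiniteMeasure m] {f : α → ℂ}
    (hf : AEStronglyMeasurable f m) (h : luxemburg Φ m f < ∞) : Integrable f m := by
  obtain ⟨k, hk, hmod, -⟩ := exists_of_luxemburg_lt h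
  obtain ⟨y, hy⟩ := Φ.exists_le_add_mul
  refine ⟨hf, (lintegral_enorm_le_modular hy f hk).trans_lt ?_⟩
  have hmod_ne_top : modular Φ m f k ≠ ∞ := (hmod.trans_lt ENNReal.one_lt_top).ne
  finiteness

theorem modular_div_two_le {K C : ℝ≥0} (hKC : ∀ x, Φ (2 * x) ≤ K * Φ x + C) (f : α → ℂ)
    (k : ℝ≥0) : modular Φ m f (k / 2) ≤ K * modular Φ m f k + C * m univ := by
  calc modular Φ m f (k / 2) ≤ ∫⁻ x, (K * (Φ (‖f x‖₊ / k) : ℝ≥0∞) + C) ∂m := by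
        refine lintegral_mono fun x => ?_
        rw [div_div_eq_mul_div, mul_comm, mul_div_assoc]
        rw [← ENNReal.coe_mul, ← ENNReal.coe_add]
        exact ENNReal.coe_le_coe.2 (hKC _)
    _ = K * modular Φ m f k + C * m univ := by
        rw [lintegral_add_right _ measurable_const, lintegral_const,
          lintegral_const_mul' _ _ ENNReal.coe_ne_top, modular]

theorem modular_lt_top [IsFiniteMeasure m] (hΦ : Φ.DeltaTwo) {f : α → ℂ}
    (h : luxemburg Φ m f < ∞) {k : ℝ≥0} (hk : 0 < k) : modular Φ m f k < ∞ := by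
  obtain ⟨j, hj, hmod, -⟩ := exists_of_luxemburg_lt h
  obtain ⟨K, C, hKC⟩ := hΦ.exists_le_mul_add
  have hpow : ∀ n : ℕ, modular Φ m f (j / 2 ^ n) < ∞ := fun n => by
    induction n with
    | zero => simpa using hmod.trans_lt ENNReal.one_lt_top
    | succ n ih =>
      rw [pow_succ, ← div_div]
      exact (modular_div_two_le hKC f _).trans_lt (by finiteness)
  obtain ⟨n, hn⟩ := pow_unbounded_of_one_lt (j / k) (one_lt_two : (1 : ℝ≥0) < 2)
  refine (modular_antitone f (by positivity) ?_).trans_lt (hpow n)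
  rw [div_lt_iff₀ hk] at hn
  rw [div_le_iff₀ (by positivity), mul_comm]
  exact hn.le

theorem tendsto_modular_zero_of_dominated [IsFiniteMeasure m] (hΦ : Φ.DeltaTwo) {ι : Type*}
    {l : Filter ι} [l.IsCountablyGenerated] {g : α → ℂ} (hg : luxemburg Φ m g < ∞)
    {F : ι → α → ℂ} (hF : ∀ i, AEMeasurable (F i) m) (hFg : ∀ i, ∀ᵐ x ∂m, ‖F i x‖ ≤ ‖g x‖)
    (hlim : ∀ᵐ x ∂m, Tendsto (fun i => F i x) l (𝓝 0)) {k : ℝ≥0} (hk : 0 < k) :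
    Tendsto (fun i => modular Φ m (F i) k) l (𝓝 0) := by
  rw [← lintegral_zero (μ := m)]
  refine tendsto_lintegral_filter_of_dominated_convergence' (fun x => (Φ (‖g x‖₊ / k) : ℝ≥0∞))
    (.of_forall fun i => Φ.aemeasurable_nnnorm_div (hF i) k) (.of_forall fun i => ?_)
    (modular_lt_top hΦ hg hk).ne ?_
  · filter_upwards [hFg i] with x hx
    have hx' : ‖F i x‖₊ ≤ ‖g x‖₊ := hx
    exact ENNReal.coe_le_coe.2 (Φ.mono (by gcongr))
  · filter_upwards [hlim] with x hx
    have hcont : Continuous fun z : ℂ => (Φ (‖z‖₊ / k) : ℝ≥0∞) :=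
      ENNReal.continuous_coe.comp (Φ.continuous.comp (continuous_nnnorm.div_const k))
    have h0 := (hcont.tendsto 0).comp hx
    rw [nnnorm_zero, zero_div, Φ.map_zero', ENNReal.coe_zero] at h0
    exact h0

theorem tendsto_luxemburg_zero_of_dominated [IsFiniteMeasure m] (hΦ : Φ.DeltaTwo) {ι : Type*}
    {l : Filter ι} [l.IsCountablyGenerated] {g : α → ℂ} (hg : luxemburg Φ m g < ∞)
    {F : ι → α → ℂ} (hF : ∀ i, AEMeasurable (F i) m) (hFg : ∀ i, ∀ᵐ x ∂m, ‖F i x‖ ≤ ‖g x‖)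
    (hlim : ∀ᵐ x ∂m, Tendsto (fun i => F i x) l (𝓝 0)) :
    Tendsto (fun i => luxemburg Φ m (F i)) l (𝓝 0) := by
  rw [ENNReal.tendsto_nhds_zero]
  intro ε hε
  obtain ⟨k, hk, hkε⟩ := ENNReal.lt_iff_exists_nnreal_btwn.1 hε
  have hk_pos : 0 < k := by exact_mod_cast hk
  filter_upwards [(tendsto_modular_zero_of_dominated hΦ hg hF hFg hlim
    hk_pos).eventually_le_const one_pos] with i hi
  exact (luxemburg_le hk_pos hi).trans hkε.le

namespace Orlicz

theorem luxemburg_lt_top (f : Orlicz Φ m) : luxemburg Φ m f < ∞ := f.2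

theorem enorm_def (f : Orlicz Φ m) : ‖f‖ₑ = luxemburg Φ m f := by
  rw [← ofReal_norm, norm_def, ENNReal.ofReal_toReal f.luxemburg_lt_top.ne]

/-- The element of the Orlicz space represented by a function of finite Luxemburg norm. -/
noncomputable def mk (f : α → ℂ) (hf : AEStronglyMeasurable f m) (h : luxemburg Φ m f < ∞) :
    Orlicz Φ m :=
  ⟨AEEqFun.mk f hf, (luxemburg_congr (AEEqFun.coeFn_mk f hf)).trans_lt h⟩

theorem coeFn_mk (f : α → ℂ) (hf : AEStronglyMeasurable f m) (h : luxemburg Φ m f < ∞) :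
    (mk f hf h : Orlicz Φ m) =ᵐ[m] f := AEEqFun.coeFn_mk f hf

theorem enorm_mk {f : α → ℂ} (hf : AEStronglyMeasurable f m) (hfΦ : luxemburg Φ m f < ∞) :
    ‖(mk f hf hfΦ : Orlicz Φ m)‖ₑ = luxemburg Φ m f :=
  (enorm_def _).trans (luxemburg_congr (coeFn_mk f hf hfΦ))

theorem mk_add_mk {f g : α → ℂ} (hf : AEStronglyMeasurable f m) (hfΦ : luxemburg Φ m f < ∞)
    (hg : AEStronglyMeasurable g m) (hgΦ : luxemburg Φ m g < ∞) :
    (mk f hf hfΦ + mk g hg hgΦ : Orlicz Φ m) =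
      mk (f + g) (hf.add hg)
        ((luxemburg_add_le hf.aemeasurable).trans_lt (ENNReal.add_lt_top.2 ⟨hfΦ, hgΦ⟩)) := rfl

theorem coeFn_chi [IsFiniteMeasure m] (A : Set α) (hA : MeasurableSet A) :
    chi Φ m A hA =ᵐ[m] A.indicator fun _ => 1 := AEEqFun.coeFn_mk _ _

theorem coeFn_zero : ((0 : Orlicz Φ m) : α → ℂ) =ᵐ[m] 0 := AEEqFun.coeFn_zero

theorem coeFn_sub (f g : Orlicz Φ m) : (f - g) =ᵐ[m] fun x => f x - g x :=
  AEEqFun.coeFn_sub f.1 g.1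

theorem ext {f g : Orlicz Φ m} (h : f =ᵐ[m] g) : f = g := Subtype.ext (AEEqFun.ext h)

theorem measurable (f : Orlicz Φ m) : Measurable f := f.1.stronglyMeasurable.measurable

variable [IsFiniteMeasure m]

theorem integrable (f : Orlicz Φ m) : Integrable f m :=
  integrable_of_luxemburg_lt_top f.measurable.aestronglyMeasurable f.luxemburg_lt_top

theorem tendsto_of_dominated (hΦ : Φ.DeltaTwo) {ι : Type*} {l : Filter ι}
    [l.IsCountablyGenerated] {F : ι → Orlicz Φ m} {f : Orlicz Φ m} {g : α → ℂ}
    (hg : luxemburg Φ m g < ∞) (hFg : ∀ i, ∀ᵐ x ∂m, ‖F i x - f x‖ ≤ ‖g x‖)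
    (hlim : ∀ᵐ x ∂m, Tendsto (fun i => F i x) l (𝓝 (f x))) : Tendsto F l (𝓝 f) := by
  rw [tendsto_iff_norm_sub_tendsto_zero]
  have h := tendsto_luxemburg_zero_of_dominated hΦ hg
    (fun i => (F i).aemeasurable.sub f.aemeasurable) hFg
    (hlim.mono fun x hx => by simpa using hx.sub_const (f x))
  refine ((ENNReal.tendsto_toReal ENNReal.zero_ne_top).comp h).congr fun i => ?_
  rw [norm_def, luxemburg_congr (coeFn_sub (F i) f)]
  rfl

theorem mk_indicator_const (c : ℂ) {A : Set α} (hA : MeasurableSet A)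
    (hf : AEStronglyMeasurable (A.indicator fun _ => c) m)
    (hfΦ : luxemburg Φ m (A.indicator fun _ => c) < ∞) : mk _ hf hfΦ = c • chi Φ m A hA := by
  refine ext ?_
  filter_upwards [coeFn_mk _ hf hfΦ, coeFn_smul c (chi Φ m A hA),
    coeFn_chi (Φ := Φ) (m := m) A hA] with x hmk hsmul hchi
  rw [hmk, hsmul, hchi]
  by_cases hx : x ∈ A <;> simp [hx]

theorem chi_eq_zero {A : Set α} (hA : MeasurableSet A) (h : m A = 0) : chi Φ m A hA = 0 :=
  ext ((coeFn_chi A hA).trans ((indicator_meas_zero h).trans coeFn_zero.symm))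

theorem coeFn_chi_univ : chi Φ m univ .univ =ᵐ[m] fun _ => 1 := by
  simpa only [indicator_univ] using coeFn_chi (Φ := Φ) (m := m) univ .univ

theorem coeFn_sum_chi {ι : Type*} {A : ι → Set α} (hA : ∀ i, MeasurableSet (A i))
    (hd : Pairwise (Function.onFun Disjoint A)) (s : Finset ι) :
    (∑ i ∈ s, chi Φ m (A i) (hA i) : Orlicz Φ m) =ᵐ[m] (⋃ i ∈ s, A i).indicator fun _ => 1 := by
  classical
  induction s using Finset.induction_on with
  | empty => simpa using! coeFn_zero
  | insert i s hi ih =>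
    rw [Finset.sum_insert hi]
    filter_upwards [coeFn_add (chi Φ m (A i) (hA i)) (∑ i ∈ s, chi Φ m (A i) (hA i)), ih,
      coeFn_chi (Φ := Φ) (m := m) (A i) (hA i)] with x hadd hs hi'
    have hdisj : Disjoint (A i) (⋃ j ∈ s, A j) :=
      disjoint_iUnion₂_right.2 fun j hj => hd (ne_of_mem_of_not_mem hj hi).symm
    rw [hadd, hs, hi', Finset.set_biUnion_insert, indicator_union_of_disjoint hdisj]

theorem hasSum_chi (hΦ : Φ.DeltaTwo) {ι : Type*} [Countable ι] {A : ι → Set α}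
    (hA : ∀ i, MeasurableSet (A i)) (hd : Pairwise (Function.onFun Disjoint A)) :
    HasSum (fun i => chi Φ m (A i) (hA i)) (chi Φ m (⋃ i, A i) (.iUnion hA)) := by
  have hsum : ∀ᵐ x ∂m, ∀ s : Finset ι, (∑ i ∈ s, chi Φ m (A i) (hA i) : Orlicz Φ m) x =
      (⋃ i ∈ s, A i).indicator (fun _ => 1) x := ae_all_iff.2 (coeFn_sum_chi hA hd)
  have hunion := coeFn_chi (Φ := Φ) (m := m) (⋃ i, A i) (.iUnion hA)
  refine tendsto_of_dominated hΦ (luxemburg_const_lt_top 1) (fun s => ?_) ?_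
  · filter_upwards [hsum, hunion] with x hx hx'
    have hsub : ⋃ i ∈ s, A i ⊆ ⋃ i, A i := iUnion₂_subset_iUnion _ _
    rw [hx, hx', norm_sub_rev, ← Pi.sub_apply, ← indicator_sdiff hsub]
    exact norm_indicator_le_norm_self _ _
  · filter_upwards [hsum, hunion] with x hx hx'
    simp only [hx, hx']
    exact (tendsto_indicator_biUnion_finset A (fun _ => 1) x).mono_right (pure_le_nhds _)

end Orlicz

end Orlicz

section VectorMeasure

variable {Ω : Type*} [MeasurableSpace Ω] {X : Type*} [NormedAddCommGroup X] [NormedSpace ℂ X]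
  {ν : VectorMeasure Ω X}

theorem lintegral_variation_le_vNorm (f : Ω → ℂ) {ℓ : StrongDual ℂ X} (hℓ : ‖ℓ‖ ≤ 1) :
    ∫⁻ x, ‖f x‖ₑ ∂(scalarMeasure ν ℓ).variation ≤ vNorm ν f :=
  le_iSup₂ (f := fun (ℓ : StrongDual ℂ X) (_ : ‖ℓ‖ ≤ 1) =>
    ∫⁻ x, ‖f x‖ₑ ∂(scalarMeasure ν ℓ).variation) ℓ hℓ

theorem exists_enorm_le_variation_scalarMeasure (ν : VectorMeasure Ω X) (A : Set Ω) :
    ∃ ℓ : StrongDual ℂ X, ‖ℓ‖ ≤ 1 ∧ ‖ν A‖ₑ ≤ (scalarMeasure ν ℓ).variation A := by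
  obtain ⟨ℓ, hℓ, hℓA⟩ := exists_dual_vector'' ℂ (ν A)
  refine ⟨ℓ, hℓ, le_trans (le_of_eq ?_) (VectorMeasure.enorm_measure_le_variation _ A)⟩
  rw [scalarMeasure_apply, hℓA, ← ofReal_norm, ← ofReal_norm, RCLike.norm_ofReal, abs_norm]

theorem enorm_univ_le_vNorm_one (ν : VectorMeasure Ω X) : ‖ν univ‖ₑ ≤ vNorm ν fun _ => 1 := by
  obtain ⟨ℓ, hℓ, hle⟩ := exists_enorm_le_variation_scalarMeasure ν univ
  exact hle.trans (le_trans (by simp) (lintegral_variation_le_vNorm (fun _ => 1) hℓ))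

theorem measure_support_eq_zero_of_vNorm_eq_zero {f : Ω → ℂ} (hf : Measurable f)
    (h : vNorm ν f = 0) : ν (Function.support f) = 0 := by
  obtain ⟨ℓ, hℓ, hle⟩ := exists_enorm_le_variation_scalarMeasure ν (Function.support f)
  have hint : ∫⁻ x, ‖f x‖ₑ ∂(scalarMeasure ν ℓ).variation = 0 :=
    nonpos_iff_eq_zero.1 ((lintegral_variation_le_vNorm f hℓ).trans_eq h)
  have hnull : f =ᵐ[(scalarMeasure ν ℓ).variation] 0 := by
    filter_upwards [(lintegral_eq_zero_iff hf.enorm).1 hint] with x hx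
    exact enorm_eq_zero.1 hx
  exact enorm_eq_zero.1 (nonpos_iff_eq_zero.1 (hle.trans_eq (ae_iff.1 hnull)))

theorem VL1.enorm_mk (f : Ω → ℂ) (hf : IsVIntegrable ν f) : ‖VL1.mk f hf‖ₑ = vNorm ν f := by
  rw [← ofReal_norm]
  exact ENNReal.ofReal_toReal (vNorm_lt_top hf.1).ne

end VectorMeasure

section AssociatedMeasure

variable {α : Type*} [MeasurableSpace α] {m : Measure α} [IsFiniteMeasure m] {Φ : YoungFunction}
  {X : Type*} [NormedAddCommGroup X] [NormedSpace ℂ X]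

open scoped Classical in
/-- The vector measure `A ↦ T χ_A` associated with an operator `T` on an Orlicz space; it vanishes
on non-measurable sets. -/
noncomputable def assocMeasure (hΦ : Φ.DeltaTwo) (T : Orlicz Φ m →L[ℂ] X) : VectorMeasure α X where
  measureOf' A := if hA : MeasurableSet A then T (Orlicz.chi Φ m A hA) else 0
  empty' := by
    rw [dif_pos MeasurableSet.empty, Orlicz.chi_eq_zero _ measure_empty, map_zero]
  not_measurable' A hA := dif_neg hA
  m_iUnion' A hA hd := by
    simp only [hA, MeasurableSet.iUnion hA, dif_pos]
    exact T.hasSum (Orlicz.hasSum_chi hΦ hA hd)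

variable (hΦ : Φ.DeltaTwo) (T : Orlicz Φ m →L[ℂ] X)

theorem assocMeasure_apply (A : Set α) (hA : MeasurableSet A) :
    assocMeasure hΦ T A = T (Orlicz.chi Φ m A hA) := dif_pos hA

theorem variation_scalarMeasure_absolutelyContinuous (ℓ : StrongDual ℂ X) :
    (scalarMeasure (assocMeasure hΦ T) ℓ).variation ≪ m :=
  Measure.AbsolutelyContinuous.mk fun A hA hA0 =>
    (VectorMeasure.variation_apply_eq_zero hA).2 fun B hBA hB => by
      rw [scalarMeasure_apply, assocMeasure_apply hΦ T B hB,
        Orlicz.chi_eq_zero hB (measure_mono_null hBA hA0), map_zero, map_zero]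

theorem vNorm_congr_ae {f g : α → ℂ} (h : f =ᵐ[m] g) :
    vNorm (assocMeasure hΦ T) f = vNorm (assocMeasure hΦ T) g :=
  iSup_congr fun ℓ => iSup_congr fun _ => lintegral_congr_ae <|
    ((variation_scalarMeasure_absolutelyContinuous hΦ T ℓ).ae_eq h).fun_comp enorm

theorem VL1.mk_eq_mk_of_ae {f g : α → ℂ} (hf : IsVIntegrable (assocMeasure hΦ T) f)
    (hg : IsVIntegrable (assocMeasure hΦ T) g) (h : f =ᵐ[m] g) : VL1.mk f hf = VL1.mk g hg := by
  refine SeparationQuotient.mk_eq_mk.2 (Metric.inseparable_iff.2 ?_)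
  have hsub : vNorm (assocMeasure hΦ T) (f - g) = 0 :=
    (vNorm_congr_ae hΦ T (h.sub_eq)).trans vNorm_zero
  exact (dist_eq_norm _ _).trans ((congrArg ENNReal.toReal hsub).trans ENNReal.toReal_zero)

theorem integral_simpleFunc (ℓ : StrongDual ℂ X) (s : SimpleFunc α ℂ) :
    (scalarMeasure (assocMeasure hΦ T) ℓ).integral s (ContinuousLinearMap.mul ℝ ℂ) =
      ℓ (T (Orlicz.mk s s.aestronglyMeasurable (luxemburg_simpleFunc_lt_top s))) := by
  induction s using SimpleFunc.induction with
  | @const c A hA =>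
    have hcoe : ⇑(SimpleFunc.piecewise A hA (SimpleFunc.const α c) (SimpleFunc.const α 0)) =
        A.indicator fun _ => c := by
      classical exact piecewise_eq_indicator
    simp only [hcoe]
    rw [Orlicz.mk_indicator_const c hA, map_smul, map_smul, ← assocMeasure_apply hΦ T A hA,
      ← scalarMeasure_apply]
    exact VectorMeasure.integral_indicator_const c hA
  | @add s t _ hs ht =>
    simp only [SimpleFunc.coe_add]
    rw [VectorMeasure.integral_add (SimpleFunc.integrable_of_isFiniteMeasure s)
      (SimpleFunc.integrable_of_isFiniteMeasure t), hs, ht, ← map_add, ← map_add, Orlicz.mk_add_mk]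

theorem integral_eq_of_integrable (ℓ : StrongDual ℂ X) {f : α → ℂ} (hf : Measurable f)
    (hfΦ : luxemburg Φ m f < ∞) (hfi : (scalarMeasure (assocMeasure hΦ T) ℓ).Integrable f) :
    (scalarMeasure (assocMeasure hΦ T) ℓ).integral f (ContinuousLinearMap.mul ℝ ℂ) =
      ℓ (T (Orlicz.mk f hf.aestronglyMeasurable hfΦ)) := by
  let s : ℕ → SimpleFunc α ℂ := SimpleFunc.approxOn f hf univ 0 (mem_univ 0)
  have hs_le (n x) : ‖s n x‖ ≤ ‖f x‖ + ‖f x‖ := SimpleFunc.norm_approxOn_zero_le hf _ x n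
  have hs_lim (x) : Tendsto (fun n => s n x) atTop (𝓝 (f x)) :=
    SimpleFunc.tendsto_approxOn hf _ (by simp)
  let S (n : ℕ) : Orlicz Φ m :=
    Orlicz.mk (s n) (s n).aestronglyMeasurable (luxemburg_simpleFunc_lt_top _)
  have hS : ∀ᵐ x ∂m, ∀ n, S n x = s n x := ae_all_iff.2 fun n => Orlicz.coeFn_mk _ _ _
  have hmk := Orlicz.coeFn_mk f hf.aestronglyMeasurable hfΦ
  have hS_lim : Tendsto S atTop (𝓝 (Orlicz.mk f hf.aestronglyMeasurable hfΦ)) := by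
    refine Orlicz.tendsto_of_dominated hΦ (g := fun x => 3 * f x) ?_ (fun n => ?_) ?_
    · rw [luxemburg_const_mul]
      exact ENNReal.mul_lt_top ENNReal.coe_lt_top hfΦ
    · filter_upwards [hS, hmk] with x hx hx'
      rw [hx, hx', norm_mul, RCLike.norm_ofNat]
      linarith [norm_sub_le (s n x) (f x), hs_le n x]
    · filter_upwards [hS, hmk] with x hx hx'
      simp only [hx, hx', hs_lim x]
  refine tendsto_nhds_unique (VectorMeasure.tendsto_integral_of_dominated_convergence
    (fun x => ‖f x‖ + ‖f x‖) (fun n => (s n).aestronglyMeasurable) (hfi.norm.add hfi.norm)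
    (fun n => .of_forall (hs_le n)) (.of_forall hs_lim)) ?_
  simp only [integral_simpleFunc hΦ T ℓ]
  exact ((ℓ.continuous.comp T.continuous).tendsto _).comp hS_lim

theorem lintegral_variation_le_of_bound (ℓ : StrongDual ℂ X) {f : α → ℂ} (hf : Measurable f)
    {C : ℝ} (hC : ∀ x, ‖f x‖ ≤ C) :
    ∫⁻ x, ‖f x‖ₑ ∂(scalarMeasure (assocMeasure hΦ T) ℓ).variation ≤
      ‖ℓ‖ₑ * (‖T‖ₑ * luxemburg Φ m f) := by
  set ξ := scalarMeasure (assocMeasure hΦ T) ℓ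
  let w : α → ℂ := fun x => ‖f x‖ * (starRingEnd ℂ) (phase ξ x)
  have hw : Measurable w := (Complex.measurable_ofReal.comp hf.norm).mul
    (Complex.continuous_conj.measurable.comp (measurable_phase ξ))
  have hwf (x) : ‖w x‖ = ‖f x‖ := by simp [w]
  have hwξ (x) : w x * phase ξ x = (‖f x‖ : ℝ) := by
    simp [w, mul_assoc, Complex.conj_mul']
  have hwC (x) : ‖w x‖ ≤ C := (hwf x).trans_le (hC x)
  have hwi : ξ.Integrable w :=
    Integrable.of_bound (μ := ξ.variation) hw.aestronglyMeasurable C (.of_forall hwC)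
  have hwΦ : luxemburg Φ m w < ∞ := luxemburg_lt_top_of_bound hwC
  have hint := integral_eq_of_integrable hΦ T ℓ hw hwΦ hwi
  rw [integral_eq_integral_mul_phase hwi] at hint
  simp only [hwξ, integral_complex_ofReal] at hint
  have hfi : Integrable f ξ.variation :=
    Integrable.of_bound hf.aestronglyMeasurable C (.of_forall hC)
  calc ∫⁻ x, ‖f x‖ₑ ∂ξ.variation = ‖((∫ x, ‖f x‖ ∂ξ.variation : ℝ) : ℂ)‖ₑ := by
        rw [← ofReal_integral_norm_eq_lintegral_enorm hfi, ← ofReal_norm, Complex.norm_real,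
          Real.norm_of_nonneg (by positivity)]
    _ ≤ ‖ℓ‖ₑ * (‖T‖ₑ * ‖Orlicz.mk w hw.aestronglyMeasurable hwΦ‖ₑ) := by
        rw [hint]
        exact (ℓ.le_opENorm _).trans (mul_le_mul_right (T.le_opENorm _) _)
    _ ≤ ‖ℓ‖ₑ * (‖T‖ₑ * luxemburg Φ m f) := by
        rw [Orlicz.enorm_mk]
        gcongr
        exact luxemburg_mono (.of_forall fun x => (hwf x).le)

theorem lintegral_variation_le (ℓ : StrongDual ℂ X) {f : α → ℂ} (hf : Measurable f) :
    ∫⁻ x, ‖f x‖ₑ ∂(scalarMeasure (assocMeasure hΦ T) ℓ).variation ≤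
      ‖ℓ‖ₑ * (‖T‖ₑ * luxemburg Φ m f) := by
  let F (n : ℕ) : α → ℂ := {x | ‖f x‖ ≤ n}.indicator f
  have hF (n) : Measurable (F n) := hf.indicator (measurableSet_le hf.norm measurable_const)
  have hF_bound (n x) : ‖F n x‖ ≤ n := by
    by_cases hx : ‖f x‖ ≤ n <;> simp [F, hx]
  have hF_lim (x) : Tendsto (fun n => ‖F n x‖ₑ) atTop (𝓝 ‖f x‖ₑ) := by
    refine tendsto_const_nhds.congr' ?_
    filter_upwards [eventually_ge_atTop ⌈‖f x‖⌉₊] with n hn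
    have hx : x ∈ {x | ‖f x‖ ≤ n} := Nat.ceil_le.1 hn
    simp only [F, indicator_of_mem hx]
  simp only [← fun x => (hF_lim x).liminf_eq]
  refine (lintegral_liminf_le fun n => (hF n).enorm).trans
    ((liminf_le_liminf (.of_forall fun n => ?_)).trans_eq (liminf_const _))
  refine (lintegral_variation_le_of_bound hΦ T ℓ (hF n) (hF_bound n)).trans ?_
  gcongr
  exact luxemburg_mono (.of_forall fun x => norm_indicator_le_norm_self _ _)

theorem vNorm_le {f : α → ℂ} (hf : Measurable f) :
    vNorm (assocMeasure hΦ T) f ≤ ‖T‖ₑ * luxemburg Φ m f :=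
  iSup₂_le fun ℓ hℓ => (lintegral_variation_le hΦ T ℓ hf).trans
    (mul_le_of_le_one_left zero_le (by simpa [← ofReal_norm] using hℓ))

theorem isVIntegrable_of_luxemburg_lt_top {f : α → ℂ} (hf : Measurable f)
    (hfΦ : luxemburg Φ m f < ∞) : IsVIntegrable (assocMeasure hΦ T) f := by
  have hfi (ℓ : StrongDual ℂ X) : (scalarMeasure (assocMeasure hΦ T) ℓ).Integrable f :=
    ⟨hf.aestronglyMeasurable, (lintegral_variation_le hΦ T ℓ hf).trans_lt (by finiteness)⟩
  refine ⟨⟨hf, hfi⟩, fun A hA => ?_⟩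
  have hAΦ : luxemburg Φ m (A.indicator f) < ∞ :=
    (luxemburg_mono (.of_forall fun x => norm_indicator_le_norm_self _ _)).trans_lt hfΦ
  refine ⟨T (Orlicz.mk _ (hf.indicator hA).aestronglyMeasurable hAΦ), fun ℓ => ?_⟩
  rw [← VectorMeasure.integral_indicator hA]
  exact integral_eq_of_integrable hΦ T ℓ (hf.indicator hA) hAΦ
    (MeasureTheory.Integrable.indicator (hfi ℓ) hA)

theorem Orlicz.isVIntegrable (f : Orlicz Φ m) : IsVIntegrable (assocMeasure hΦ T) f :=
  isVIntegrable_of_luxemburg_lt_top hΦ T f.measurable f.luxemburg_lt_top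

/-- The inclusion of the Orlicz space in `L¹(ν)`, for the vector measure `ν : A ↦ T χ_A`. -/
noncomputable def inclusion : Orlicz Φ m →L[ℂ] VL1 (assocMeasure hΦ T) :=
  LinearMap.mkContinuous
    { toFun f := VL1.mk f (f.isVIntegrable hΦ T)
      map_add' f g := (VL1.mk_eq_mk_of_ae hΦ T _ ((integrableSubmodule _).add_mem
        (f.isVIntegrable hΦ T) (g.isVIntegrable hΦ T)) (Orlicz.coeFn_add f g)).trans rfl
      map_smul' c f := (VL1.mk_eq_mk_of_ae hΦ T _ ((integrableSubmodule _).smul_mem c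
        (f.isVIntegrable hΦ T)) (Orlicz.coeFn_smul c f)).trans rfl }
    ‖T‖ fun f => by
      rw [← ENNReal.ofReal_le_ofReal_iff (by positivity), ENNReal.ofReal_mul (norm_nonneg T)]
      simp only [ofReal_norm]
      exact (VL1.enorm_mk f _).trans_le ((vNorm_le hΦ T f.measurable).trans_eq
        (by rw [Orlicz.enorm_def]))

theorem exists_inclusion_eq_mk (f : Orlicz Φ m) {g : α → ℂ} (hg : Measurable g) (h : g =ᵐ[m] f) :
    ∃ hgν : IsVIntegrable (assocMeasure hΦ T) g, inclusion hΦ T f = VL1.mk g hgν :=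
  ⟨isVIntegrable_of_luxemburg_lt_top hΦ T hg ((luxemburg_congr h).trans_lt f.luxemburg_lt_top),
    VL1.mk_eq_mk_of_ae hΦ T (f.isVIntegrable hΦ T) _ h.symm⟩

theorem enorm_inclusion (f : Orlicz Φ m) : ‖inclusion hΦ T f‖ₑ = vNorm (assocMeasure hΦ T) f :=
  VL1.enorm_mk f _

theorem norm_inclusion_le : ‖inclusion hΦ T‖ ≤ ‖T‖ :=
  LinearMap.mkContinuous_norm_le _ (norm_nonneg T) _

theorem inclusion_injective
    (hT : ∀ A (hA : MeasurableSet A), T (Orlicz.chi Φ m A hA) = 0 → m A = 0) :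
    Function.Injective (inclusion hΦ T) := by
  refine (injective_iff_map_eq_zero _).2 fun f hf => Orlicz.ext (.trans ?_ Orlicz.coeFn_zero.symm)
  have hnorm : vNorm (assocMeasure hΦ T) f = 0 := by rw [← enorm_inclusion, hf, enorm_zero]
  have hsupp : MeasurableSet (Function.support f) :=
    measurableSet_support f.measurable
  have hν := measure_support_eq_zero_of_vNorm_eq_zero f.measurable hnorm
  rw [assocMeasure_apply hΦ T _ hsupp] at hν
  exact ae_iff.2 (hT _ hsupp hν)

theorem norm_map_chi_univ_le_norm_inclusion :
    ‖T (Orlicz.chi Φ m univ .univ)‖ ≤ ‖inclusion hΦ T‖ * ‖Orlicz.chi Φ m univ .univ‖ := by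
  refine le_trans (enorm_le_iff_norm_le.1 ?_) ((inclusion hΦ T).le_opNorm _)
  rw [← assocMeasure_apply hΦ T, enorm_inclusion, vNorm_congr_ae hΦ T Orlicz.coeFn_chi_univ]
  exact enorm_univ_le_vNorm_one _

end AssociatedMeasure

section InvMul

theorem prod_preimage_inv_mul_of_measurableSet {G : Type*} [Group G] [MeasurableSpace G]
    [MeasurableMul G] {m : Measure G} [m.IsMulLeftInvariant] [SFinite m] (ρ : Measure G) [SFinite ρ]
    {K : Set G}
    (hK : MeasurableSet ((fun p : G × G => p.2⁻¹ * p.1) ⁻¹' K)) :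
    (m.prod ρ) ((fun p : G × G => p.2⁻¹ * p.1) ⁻¹' K) = ρ univ * m K := by
  have hslice : ∀ s : G, m ((fun t => (t, s)) ⁻¹' ((fun p : G × G => p.2⁻¹ * p.1) ⁻¹' K)) = m K :=
    fun s => measure_preimage_mul m s⁻¹ K
  simp only [Measure.prod_apply_symm hK, hslice, lintegral_const, mul_comm]

variable {G : Type*} [TopologicalSpace G] [Group G] [IsTopologicalGroup G] [CompactSpace G]
  [MeasurableSpace G] [BorelSpace G]

theorem measurable_comp_inv_mul {f : G → ℝ} (hf : Continuous f) :
    Measurable fun p : G × G => f (p.2⁻¹ * p.1) := by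
  have hc : Continuous fun p : G × G => f (p.2⁻¹ * p.1) := by fun_prop
  exact (HasCompactSupport.stronglyMeasurable_of_prod hc (.of_compactSpace _)).measurable

/-- The product of the Borel `σ`-algebras may be smaller than the Borel `σ`-algebra of `G × G`; the
set `K` is a countable union of level sets of continuous functions. -/
theorem exists_subset_measurableSet_preimage_inv_mul (m : Measure G) [m.IsMulLeftInvariant]
    [m.InnerRegularCompactLTTop] [IsFiniteMeasure m] {A : Set G} (hA : MeasurableSet A) :
    ∃ K ⊆ A, MeasurableSet K ∧ MeasurableSet ((fun p : G × G => p.2⁻¹ * p.1) ⁻¹' K) ∧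
      m (A \ K) = 0 := by
  rcases eq_or_ne (m A) 0 with h0 | h0
  · exact ⟨∅, empty_subset A, .empty, by simp, by simpa using h0⟩
  obtain ⟨u, -, hu, hlim⟩ := exists_seq_strictMono_tendsto' (pos_iff_ne_zero.2 h0)
  have hlevel : ∀ n, ∃ f : G → ℝ, Continuous f ∧ f ⁻¹' {1} ⊆ A ∧ u n < m (f ⁻¹' {1}) := fun n => by
    obtain ⟨K, hKA, ⟨f, hf, -, rfl⟩, hlt⟩ :=
      Measure.innerRegularWRT_preimage_one_hasCompactSupport_measure_ne_top_of_group (μ := m)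
        ⟨hA, measure_ne_top m A⟩ (u n) (hu n).2
    exact ⟨f, hf, hKA, hlt⟩
  choose f hf hfA hlt using hlevel
  have hK : MeasurableSet (⋃ n, f n ⁻¹' {1}) :=
    .iUnion fun n => (hf n).measurable (measurableSet_singleton 1)
  refine ⟨⋃ n, f n ⁻¹' {1}, iUnion_subset hfA, hK, ?_, ?_⟩
  · rw [preimage_iUnion]
    exact .iUnion fun n => measurable_comp_inv_mul (hf n) (measurableSet_singleton 1)
  · rw [measure_sdiff (iUnion_subset hfA) hK.nullMeasurableSet (measure_ne_top m _)]
    refine tsub_eq_zero_of_le (le_of_tendsto' hlim fun n => ?_)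
    exact (hlt n).le.trans (measure_mono (subset_iUnion (fun n => f n ⁻¹' {1}) n))

variable {m : Measure G} [m.IsMulLeftInvariant] [m.InnerRegularCompactLTTop] [IsFiniteMeasure m]
  (ρ : Measure G) [IsFiniteMeasure ρ]

theorem prod_preimage_inv_mul_eq_zero {A : Set G} (hA : MeasurableSet A) (h : m A = 0) :
    (m.prod ρ) ((fun p : G × G => p.2⁻¹ * p.1) ⁻¹' A) = 0 := by
  obtain ⟨K, hKA, -, hqK, hK0⟩ := exists_subset_measurableSet_preimage_inv_mul m hA.compl
  have hKc : m Kᶜ = 0 := measure_mono_null (t := A ∪ Aᶜ \ K)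
    (fun x hx => (em (x ∈ A)).imp id fun hxA => ⟨hxA, hx⟩) (measure_union_null h hK0)
  refine measure_mono_null (preimage_mono (subset_compl_comm.1 hKA)) ?_
  rw [prod_preimage_inv_mul_of_measurableSet ρ (K := Kᶜ) hqK.compl, hKc, mul_zero]

theorem exists_measurableSet_preimage_inv_mul_ae_eq {A : Set G} (hA : MeasurableSet A) :
    ∃ K, MeasurableSet ((fun p : G × G => p.2⁻¹ * p.1) ⁻¹' K) ∧ m K = m A ∧
      (fun p : G × G => p.2⁻¹ * p.1) ⁻¹' K =ᵐ[m.prod ρ] (fun p : G × G => p.2⁻¹ * p.1) ⁻¹' A := by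
  obtain ⟨K, hKA, hK, hqK, hK0⟩ := exists_subset_measurableSet_preimage_inv_mul m hA
  refine ⟨K, hqK, measure_eq_measure_of_null_sdiff hKA hK0, ?_⟩
  exact (preimage_mono hKA).eventuallyLE.antisymm
    (ae_le_set.2 (prod_preimage_inv_mul_eq_zero ρ (hA.diff hK) hK0))

theorem nullMeasurableSet_preimage_inv_mul {A : Set G} (hA : MeasurableSet A) :
    NullMeasurableSet ((fun p : G × G => p.2⁻¹ * p.1) ⁻¹' A) (m.prod ρ) := by
  obtain ⟨K, hK, -, hKA⟩ := exists_measurableSet_preimage_inv_mul_ae_eq (m := m) ρ hA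
  exact hK.nullMeasurableSet.congr hKA

theorem prod_preimage_inv_mul {A : Set G} (hA : MeasurableSet A) :
    (m.prod ρ) ((fun p : G × G => p.2⁻¹ * p.1) ⁻¹' A) = ρ univ * m A := by
  obtain ⟨K, hK, hm, hKA⟩ := exists_measurableSet_preimage_inv_mul_ae_eq (m := m) ρ hA
  rw [← measure_congr hKA, prod_preimage_inv_mul_of_measurableSet ρ hK, hm]

theorem aemeasurable_comp_inv_mul {β : Type*} [MeasurableSpace β]
    [MeasurableSpace.CountablyGenerated β] {f : G → β} (hf : Measurable f) :
    AEMeasurable (fun p : G × G => f (p.2⁻¹ * p.1)) (m.prod ρ) :=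
  NullMeasurable.aemeasurable fun _ hs => nullMeasurableSet_preimage_inv_mul ρ (hf hs)

theorem lintegral_comp_inv_mul {f : G → ℝ≥0∞} (hf : Measurable f) :
    ∫⁻ p, f (p.2⁻¹ * p.1) ∂(m.prod ρ) = ρ univ * ∫⁻ x, f x ∂m := by
  refine Measurable.ennreal_induction
    (motive := fun f => ∫⁻ p, f (p.2⁻¹ * p.1) ∂(m.prod ρ) = ρ univ * ∫⁻ x, f x ∂m)
    (fun c A hA => ?_) (fun f g _ hf _ hf_eq hg_eq => ?_) (fun f hf hmono hf_eq => ?_) hf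
  · have hind : ∀ p : G × G, A.indicator (fun _ => c) (p.2⁻¹ * p.1) =
        ((fun p : G × G => p.2⁻¹ * p.1) ⁻¹' A).indicator (fun _ => c) p := fun _ => rfl
    rw [lintegral_congr hind, lintegral_indicator_const₀ (nullMeasurableSet_preimage_inv_mul ρ hA),
      prod_preimage_inv_mul ρ hA, lintegral_indicator_const hA, mul_left_comm]
  · simp only [Pi.add_apply]
    rw [lintegral_add_left' (aemeasurable_comp_inv_mul ρ hf), hf_eq, hg_eq, lintegral_add_left hf,
      mul_add]
  · rw [lintegral_iSup' (fun n => aemeasurable_comp_inv_mul ρ (hf n))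
      (ae_of_all _ fun p i j hij => hmono hij _), lintegral_iSup hf hmono, ENNReal.mul_iSup]
    exact iSup_congr hf_eq

theorem integrable_comp_inv_mul {f : G → ℂ} (hf : Measurable f) (hfi : Integrable f m) :
    Integrable (fun p : G × G => f (p.2⁻¹ * p.1)) (m.prod ρ) := by
  refine ⟨(aemeasurable_comp_inv_mul ρ hf).aestronglyMeasurable, ?_⟩
  exact (lintegral_comp_inv_mul ρ hf.enorm).trans_lt (ENNReal.mul_lt_top (measure_lt_top ρ _) hfi.2)

theorem ae_ae_eq_comp_inv_mul {f g : G → ℂ} (hf : Measurable f) (hg : Measurable g)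
    (h : f =ᵐ[m] g) : ∀ᵐ t ∂m, ∀ᵐ s ∂ρ, f (s⁻¹ * t) = g (s⁻¹ * t) := by
  refine Measure.ae_ae_of_ae_prod (p := fun p : G × G => f (p.2⁻¹ * p.1) = g (p.2⁻¹ * p.1)) ?_
  exact prod_preimage_inv_mul_eq_zero ρ (measurableSet_eq_fun hf hg).compl h

end InvMul

section Conv

variable {G : Type*} [Group G] [MeasurableSpace G] (μ : ComplexMeasure G)

theorem conv_add_apply {f g : G → ℂ} {t : G} (hf : μ.Integrable fun s => f (s⁻¹ * t))
    (hg : μ.Integrable fun s => g (s⁻¹ * t)) :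
    conv μ (f + g) t = conv μ f t + conv μ g t :=
  VectorMeasure.integral_fun_add hf hg

theorem conv_const_smul (c : ℂ) (f : G → ℂ) : conv μ (c • f) = c • conv μ f :=
  funext fun t => integral_const_mul μ c fun s => f (s⁻¹ * t)

theorem conv_const (c : ℂ) : conv μ (fun _ => c) = fun _ => c * μ univ := by
  funext t
  rw [conv, VectorMeasure.integral_const]
  rfl

theorem enorm_conv_le (f : G → ℂ) (t : G) :
    ‖conv μ f t‖ₑ ≤ ∫⁻ s, ‖f (s⁻¹ * t)‖ₑ ∂μ.variation := by
  refine VectorMeasure.enorm_integral_le_lintegral_enorm.trans (mul_le_of_le_one_left' ?_)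
  rw [← ofReal_norm]
  exact ENNReal.ofReal_le_one.2 (ContinuousLinearMap.opNorm_mul_le ℝ ℂ)

theorem YoungFunction.map_nnnorm_conv_div_le (Φ : YoungFunction) [NeZero μ.variation] {f : G → ℂ}
    {t : G} (hf : μ.Integrable fun s => f (s⁻¹ * t)) (k : ℝ≥0) :
    (Φ (‖conv μ f t‖₊ / ((μ.variation univ).toNNReal * k)) : ℝ≥0∞) ≤
      ⨍⁻ s, Φ (‖f (s⁻¹ * t)‖₊ / k) ∂μ.variation := by
  have hdiv : ∫⁻ s, ((‖f (s⁻¹ * t)‖₊ / k : ℝ≥0) : ℝ≥0∞) ∂μ.variation =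
      (∫⁻ s, ‖f (s⁻¹ * t)‖ₑ ∂μ.variation) * (k⁻¹ : ℝ≥0) := by
    simp only [div_eq_mul_inv, ENNReal.coe_mul, ← enorm_eq_nnnorm]
    exact lintegral_mul_const' _ _ ENNReal.coe_ne_top
  have hnorm : ‖conv μ f t‖₊ ≤ (∫⁻ s, ‖f (s⁻¹ * t)‖ₑ ∂μ.variation).toNNReal :=
    ENNReal.toNNReal_mono hf.2.ne (enorm_conv_le μ f t)
  refine le_trans ?_ (Φ.map_laverage_le (hf.1.aemeasurable.nnnorm.div_const k) ?_)
  · refine ENNReal.coe_le_coe.2 (Φ.mono ?_)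
    rw [laverage_eq, hdiv, ENNReal.toNNReal_div, ENNReal.toNNReal_mul, ENNReal.toNNReal_coe,
      mul_comm (μ.variation univ).toNNReal, ← div_div, div_eq_mul_inv _ k]
    gcongr
  · rw [hdiv]
    exact ENNReal.mul_ne_top hf.2.ne ENNReal.coe_ne_top

variable [TopologicalSpace G] [IsTopologicalGroup G] [CompactSpace G] [BorelSpace G]
  {m : Measure G} [m.IsMulLeftInvariant] [m.InnerRegularCompactLTTop] [IsFiniteMeasure m]
  {Φ : YoungFunction} {f : G → ℂ}

theorem ae_integrable_comp_inv_mul (hf : Measurable f) (hfi : Integrable f m) :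
    ∀ᵐ t ∂m, μ.Integrable fun s => f (s⁻¹ * t) :=
  (integrable_comp_inv_mul μ.variation hf hfi).prod_right_ae

theorem conv_congr_ae {g : G → ℂ} (hf : Measurable f) (hg : Measurable g) (h : f =ᵐ[m] g) :
    conv μ f =ᵐ[m] conv μ g :=
  (ae_ae_eq_comp_inv_mul μ.variation hf hg h).mono fun _ ht => VectorMeasure.integral_congr_ae ht

theorem conv_ae_eq_integral_mul_phase (hf : Measurable f) (hfi : Integrable f m) :
    conv μ f =ᵐ[m] fun t => ∫ s, f (s⁻¹ * t) * phase μ s ∂μ.variation :=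
  (ae_integrable_comp_inv_mul μ hf hfi).mono fun _ ht => integral_eq_integral_mul_phase ht

theorem integrable_comp_inv_mul_mul_phase (hf : Measurable f) (hfi : Integrable f m) :
    Integrable (fun p : G × G => f (p.2⁻¹ * p.1) * phase μ p.2) (m.prod μ.variation) :=
  (integrable_comp_inv_mul μ.variation hf hfi).mul_bdd (c := 1)
    ((measurable_phase μ).comp measurable_snd).aestronglyMeasurable
    (.of_forall fun p => (norm_phase μ p.2).le)

theorem aestronglyMeasurable_conv (hf : Measurable f) (hfi : Integrable f m) :
    AEStronglyMeasurable (conv μ f) m :=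
  (integrable_comp_inv_mul_mul_phase μ hf hfi).integral_prod_left.1.congr
    (conv_ae_eq_integral_mul_phase μ hf hfi).symm

theorem integral_conv (hf : Measurable f) (hfi : Integrable f m) :
    ∫ t, conv μ f t ∂m = μ univ * ∫ t, f t ∂m := by
  have hphase : ∫ s, phase μ s ∂μ.variation = μ univ := by
    rw [← setIntegral_univ, ← withDensityᵥ_apply (integrable_phase μ) .univ, withDensityᵥ_phase]
  calc ∫ t, conv μ f t ∂m
      = ∫ t, ∫ s, f (s⁻¹ * t) * phase μ s ∂μ.variation ∂m :=
        integral_congr_ae (conv_ae_eq_integral_mul_phase μ hf hfi)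
    _ = ∫ s, ∫ t, f (s⁻¹ * t) * phase μ s ∂m ∂μ.variation :=
        integral_integral_swap (integrable_comp_inv_mul_mul_phase μ hf hfi)
    _ = ∫ s, (∫ t, f t ∂m) * phase μ s ∂μ.variation := by
        simp only [MeasureTheory.integral_mul_const, integral_mul_left_eq_self f]
    _ = μ univ * ∫ t, f t ∂m := by
        rw [MeasureTheory.integral_const_mul, hphase, mul_comm]

theorem modular_conv_le [NeZero μ.variation] (hf : Measurable f) (hfi : Integrable f m)
    (k : ℝ≥0) :
    modular Φ m (conv μ f) ((μ.variation univ).toNNReal * k) ≤ modular Φ m f k := by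
  have hΦf : Measurable fun x => (Φ (‖f x‖₊ / k) : ℝ≥0∞) :=
    (Φ.measurable.comp (hf.nnnorm.div_const k)).coe_nnreal_ennreal
  calc modular Φ m (conv μ f) ((μ.variation univ).toNNReal * k)
      ≤ ∫⁻ t, (μ.variation univ)⁻¹ * ∫⁻ s, Φ (‖f (s⁻¹ * t)‖₊ / k) ∂μ.variation ∂m := by
        refine lintegral_mono_ae ((ae_integrable_comp_inv_mul μ hf hfi).mono fun t ht => ?_)
        rw [mul_comm _⁻¹, ← div_eq_mul_inv, ← laverage_eq]
        exact Φ.map_nnnorm_conv_div_le μ ht k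
    _ = (μ.variation univ)⁻¹ * (μ.variation univ * modular Φ m f k) := by
        rw [lintegral_const_mul' _ _ (ENNReal.inv_ne_top.2 (NeZero.ne _)), modular,
          ← lintegral_comp_inv_mul μ.variation hΦf,
          lintegral_prod _ (aemeasurable_comp_inv_mul μ.variation hΦf)]
    _ = modular Φ m f k :=
        ENNReal.inv_mul_cancel_left (NeZero.ne _) (measure_ne_top _ _)

theorem luxemburg_conv_le (hf : Measurable f) (hfi : Integrable f m) :
    luxemburg Φ m (conv μ f) ≤ μ.variation univ * luxemburg Φ m f := by
  rcases eq_zero_or_neZero μ.variation with hμ | hμ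
  · have hconv : conv μ f = fun _ => 0 := funext fun t => by
      simpa [hμ] using enorm_conv_le μ f t
    simp [hconv, luxemburg_zero]
  have hpos : 0 < (μ.variation univ).toNNReal :=
    ENNReal.toNNReal_pos (NeZero.ne _) (measure_ne_top _ _)
  simp only [luxemburg, ENNReal.mul_iInf_of_ne (NeZero.ne (μ.variation univ)) (measure_ne_top _ _)]
  refine le_iInf₂ fun k hk => ?_
  refine (luxemburg_le (mul_pos hpos hk.1) ((modular_conv_le μ hf hfi k).trans hk.2)).trans_eq ?_
  rw [ENNReal.coe_mul, ENNReal.coe_toNNReal (measure_ne_top _ _)]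

theorem Orlicz.luxemburg_conv_lt_top (f : Orlicz Φ m) : luxemburg Φ m (conv μ f) < ∞ :=
  (luxemburg_conv_le μ f.measurable f.integrable).trans_lt
    (ENNReal.mul_lt_top (measure_lt_top _ _) f.luxemburg_lt_top)

/-- The convolution `μ * f` as an element of the Orlicz space. -/
noncomputable def Orlicz.conv (f : Orlicz Φ m) : Orlicz Φ m :=
  .mk (OrliczConv.conv μ f) (aestronglyMeasurable_conv μ f.measurable f.integrable)
    (f.luxemburg_conv_lt_top μ)

theorem Orlicz.coeFn_conv (f : Orlicz Φ m) : f.conv μ =ᵐ[m] OrliczConv.conv μ f :=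
  Orlicz.coeFn_mk _ _ _

theorem Orlicz.conv_add (f g : Orlicz Φ m) : (f + g).conv μ = f.conv μ + g.conv μ := by
  refine Orlicz.ext ?_
  filter_upwards [(f + g).coeFn_conv μ, f.coeFn_conv μ, g.coeFn_conv μ,
    Orlicz.coeFn_add (f.conv μ) (g.conv μ),
    conv_congr_ae μ (f + g).measurable (f.measurable.add g.measurable) (Orlicz.coeFn_add f g),
    ae_integrable_comp_inv_mul μ f.measurable f.integrable,
    ae_integrable_comp_inv_mul μ g.measurable g.integrable] with t hfg hf hg hsum hcongr hft hgt
  rw [hfg, hcongr, hsum, hf, hg]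
  exact conv_add_apply μ hft hgt

theorem Orlicz.conv_smul (c : ℂ) (f : Orlicz Φ m) : (c • f).conv μ = c • f.conv μ := by
  refine Orlicz.ext ?_
  filter_upwards [(c • f).coeFn_conv μ, f.coeFn_conv μ, Orlicz.coeFn_smul c (f.conv μ),
    conv_congr_ae μ (c • f).measurable (f.measurable.const_smul c) (Orlicz.coeFn_smul c f)]
    with t hcf hf hsmul hcongr
  rw [hcf, hcongr, hsmul, hf]
  exact congrFun (conv_const_smul μ c f) t

theorem Orlicz.norm_conv_le (f : Orlicz Φ m) : ‖f.conv μ‖ ≤ μ.variation.real univ * ‖f‖ := by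
  have h : ‖f.conv μ‖ₑ ≤ μ.variation univ * ‖f‖ₑ := by
    rw [Orlicz.enorm_def, Orlicz.enorm_def, luxemburg_congr (f.coeFn_conv μ)]
    exact luxemburg_conv_le μ f.measurable f.integrable
  have htop := ENNReal.mul_ne_top (measure_ne_top μ.variation univ) (enorm_ne_top (x := f))
  simpa [Measure.real] using ENNReal.toReal_mono htop h

/-- The operator `T_{Φ,μ} : f ↦ μ * f` on the Orlicz space `L^Φ(m)`. -/
noncomputable def convOperator : Orlicz Φ m →L[ℂ] Orlicz Φ m :=
  LinearMap.mkContinuous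
    { toFun := Orlicz.conv μ, map_add' := Orlicz.conv_add μ, map_smul' := Orlicz.conv_smul μ }
    (μ.variation.real univ) (Orlicz.norm_conv_le μ)

theorem coeFn_convOperator (f : Orlicz Φ m) : convOperator μ f =ᵐ[m] conv μ f :=
  f.coeFn_conv μ

theorem norm_convOperator_le :
    ‖(convOperator μ : Orlicz Φ m →L[ℂ] Orlicz Φ m)‖ ≤ μ.variation.real univ :=
  LinearMap.mkContinuous_norm_le _ measureReal_nonneg _

theorem isConvolutionOperator_convOperator :
    IsConvolutionOperator μ (convOperator μ : Orlicz Φ m →L[ℂ] Orlicz Φ m) := fun f =>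
  ⟨ae_integrable_comp_inv_mul μ f.measurable f.integrable, coeFn_convOperator μ f⟩

variable {μ} in
theorem measure_eq_zero_of_convOperator_chi_eq_zero (hμ : μ univ ≠ 0) {A : Set G}
    (hA : MeasurableSet A) (h : convOperator μ (Orlicz.chi Φ m A hA) = 0) : m A = 0 := by
  have hint := integral_conv μ (Orlicz.chi Φ m A hA).measurable (Orlicz.chi Φ m A hA).integrable
  rw [← integral_congr_ae (coeFn_convOperator μ (Orlicz.chi Φ m A hA)), h,
    integral_congr_ae Orlicz.coeFn_zero, integral_congr_ae (Orlicz.coeFn_chi A hA),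
    integral_indicator hA] at hint
  simpa [hμ, measureReal_eq_zero_iff] using hint

theorem convOperator_chi_univ :
    convOperator μ (Orlicz.chi Φ m univ .univ) = μ univ • Orlicz.chi Φ m univ .univ := by
  refine Orlicz.ext ?_
  filter_upwards [coeFn_convOperator μ (Orlicz.chi Φ m univ .univ),
    conv_congr_ae μ (Orlicz.chi Φ m univ .univ).measurable measurable_const Orlicz.coeFn_chi_univ,
    Orlicz.coeFn_smul (μ univ) (Orlicz.chi Φ m univ .univ), Orlicz.coeFn_chi_univ]
    with t hT hconv hsmul hone
  rw [hT, hconv, hsmul, hone, conv_const, one_mul, mul_one]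

end Conv

theorem Orlicz.norm_chi_univ_pos {α : Type*} [MeasurableSpace α] (Φ : YoungFunction)
    (m : Measure α) [IsFiniteMeasure m] [NeZero m] : 0 < ‖chi Φ m univ .univ‖ := by
  refine norm_pos_iff.2 fun h => ?_
  have hone := coeFn_chi_univ (Φ := Φ) (m := m)
  rw [h] at hone
  obtain ⟨_, hx⟩ := (coeFn_zero.symm.trans hone).exists
  exact zero_ne_one hx

end OrliczConv

open OrliczConv in
theorem mainTheorem9_general {G : Type*} [Group G] [TopologicalSpace G] [IsTopologicalGroup G]
    [CompactSpace G] [MeasurableSpace G] [BorelSpace G] (m : Measure G) [m.IsMulLeftInvariant]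
    [m.InnerRegularCompactLTTop] [IsFiniteMeasure m] [NeZero m] (Φ : YoungFunction)
    (hΦ : Φ.DeltaTwo) (μ : ComplexMeasure G) (hμG : μ univ ≠ 0) :
    ∃ (T : Orlicz Φ m →L[ℂ] Orlicz Φ m) (ν : VectorMeasure G (Orlicz Φ m)),
      IsConvolutionOperator μ T ∧
      IsAssociatedMeasure T ν ∧
      (∀ f : Orlicz Φ m, vNorm ν f ≤ ENNReal.ofReal (‖f‖ * μ.variation.real univ)) ∧
      ∃ ι : Orlicz Φ m →L[ℂ] VL1 ν,
        IsInclusion ν ι ∧ ‖μ univ‖ ≤ ‖ι‖ ∧ ‖ι‖ ≤ μ.variation.real univ := by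
  let T : Orlicz Φ m →L[ℂ] Orlicz Φ m := convOperator μ
  have hT : ‖T‖ ≤ μ.variation.real univ := norm_convOperator_le μ
  have hchi : ‖μ univ‖ * ‖Orlicz.chi Φ m univ .univ‖ = ‖T (Orlicz.chi Φ m univ .univ)‖ := by
    rw [convOperator_chi_univ, norm_smul]
  refine ⟨T, assocMeasure hΦ T, isConvolutionOperator_convOperator μ, assocMeasure_apply hΦ T,
    fun f => ?_, inclusion hΦ T, ⟨fun _ _ => exists_inclusion_eq_mk hΦ T _, ?_⟩, ?_,
    (norm_inclusion_le hΦ T).trans hT⟩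
  · calc vNorm (assocMeasure hΦ T) f ≤ ‖T‖ₑ * luxemburg Φ m f := vNorm_le hΦ T f.measurable
      _ = ENNReal.ofReal (‖f‖ * ‖T‖) := by
        rw [← Orlicz.enorm_def, ← ofReal_norm, ← ofReal_norm, ← ENNReal.ofReal_mul (norm_nonneg T),
          mul_comm]
      _ ≤ ENNReal.ofReal (‖f‖ * μ.variation.real univ) := by gcongr
  · exact inclusion_injective hΦ T fun A hA => measure_eq_zero_of_convOperator_chi_eq_zero hμG hA
  · exact le_of_mul_le_mul_right (hchi.trans_le (norm_map_chi_univ_le_norm_inclusion hΦ T))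
      (Orlicz.norm_chi_univ_pos Φ m)

theorem mainTheorem9 {G : Type*} [Group G] [TopologicalSpace G] [IsTopologicalGroup G]
    [CompactSpace G] [T2Space G] [MeasurableSpace G] [BorelSpace G]
    (m : Measure G) [m.IsHaarMeasure] [m.Regular] [IsProbabilityMeasure m]
    (Φ : OrliczConv.YoungFunction) (hΦ : Φ.DeltaTwo)
    (μ : ComplexMeasure G) (hμ : μ.variation.Regular) (hμG : μ univ ≠ 0) :
    ∃ (T : OrliczConv.Orlicz Φ m →L[ℂ] OrliczConv.Orlicz Φ m)
      (ν : VectorMeasure G (OrliczConv.Orlicz Φ m)),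
      OrliczConv.IsConvolutionOperator μ T ∧
      OrliczConv.IsAssociatedMeasure T ν ∧
      (∀ f : OrliczConv.Orlicz Φ m,
        OrliczConv.vNorm ν f ≤ ENNReal.ofReal (‖f‖ * μ.variation.real univ)) ∧
      ∃ ι : OrliczConv.Orlicz Φ m →L[ℂ] OrliczConv.VL1 ν,
        OrliczConv.IsInclusion ν ι ∧ ‖μ univ‖ ≤ ‖ι‖ ∧ ‖ι‖ ≤ μ.variation.real univ :=
  mainTheorem9_general m Φ hΦ μ hμG
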